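/- Let $k\ge -\tfrac12$ and $d\mu_k(x)=\frac{|x|^{2k+1}}{2^{k+1}\Gamma(k+1)}\,dx$ on $\mathbb{R}$, and write $L^p_k(\mathbb{R})=L^p(\mathbb{R},\mu_k)$ (complex-valued functions). For real $\lambda,x$ let $$E_k(-i\lambda,x)=j_k(-\lambda x)+\frac{(-i\lambda)x}{2(k+1)}\,j_{k+1}(-\lambda x),\qquad j_k(x)=\Gamma(k+1)\sum_{n=0}^\infty\frac{(-1)^n(x/2)^{2n}}{n!\,\Gamma(n+k+1)}.$$ For $M=\begin{pmatrix}a&b\\c&d\end{pmatrix}\in SL(2,\mathbb{R})$ with $b\neq 0$ the linear canonical Dunkl transform of $f\in L^1_k(\mathbb{R})$ is $$D_k^M(f)(\lambda)=\frac{1}{(ib)^{k+1}}\int_{\mathbb{R}} f(x)\,e^{\frac i2\left(\frac db\lambda^2+\frac ab x^2\right)}E_k(-i\lambda/b,x)\,d\mu_k(x)$$ (principal power). Let $1<p\le 2$, let $q=p/(p-1)$ be the conjugate exponent, and let $0<\alpha<\frac{2(k+1)}{q}$ and $\beta>0$. For every $b\ne0$ there is a constant $C>0$, depending only on $k,p,\alpha,\beta,b$,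 such that for every $M\in SL(2,\mathbb{R})$ with upper right entry $b$ and every $f\in L^p_k(\mathbb{R})$, the transform $D_k^M(f)\in L^q_k(\mathbb{R})$ is well defined by continuous extension from $L^1_k\cap L^p_k$ (that is, there is a unique $g=D_k^M(f)\in L^q_k$, up to equality almost everywhere, for which there exist $f_n\in L^1_k\cap L^p_k$ with $f_n\to f$ in $L^p_k$ and $D_k^M(f_n)\to g$ in $L^q_k$), and $$\|D_k^M(f)\|_{L^q_k(\mathbb{R})}\le C\,\big\||y|^\alpha f\big\|_{L^p_k(\mathbb{R})}^{\frac{\beta}{\alpha+\beta}}\,\big\||\lambda|^\beta D_k^M(f)\big\|_{L^q_k(\mathbb{R})}^{\frac{\alpha}{\alpha+\beta}}.$$ Here the weighted norms on the right may be infinite, with the convention $0\cdot\infty=0$. -/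

import Mathlib

open MeasureTheory Filter Topology

noncomputable section

namespace Dunkl

/-- The weighted measure `dμ_k(x) = |x|^(2k+1) / (2^(k+1) Γ(k+1)) dx` on the real line. -/
def dunklMeasure (k : ℝ) : Measure ℝ :=
  volume.withDensity fun x =>
    ENNReal.ofReal (|x| ^ (2 * k + 1) / ((2 : ℝ) ^ (k + 1) * Real.Gamma (k + 1)))

/-- The normalized spherical Bessel function
`j_k(x) = Γ(k+1) ∑ (-1)^n (x/2)^(2n) / (n! Γ(n+k+1))`. -/
def sphericalBessel (k x : ℝ) : ℝ :=
  Real.Gamma (k + 1) *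
    ∑' n : ℕ, (-1 : ℝ) ^ n * (x / 2) ^ (2 * n) / ((n.factorial : ℝ) * Real.Gamma (n + k + 1))

/-- The Dunkl kernel on the imaginary axis: `dunklKernel k lam x` is `E_k(-i lam, x)`, that is
`j_k(-lam x) + (-i lam) x / (2 (k+1)) * j_{k+1}(-lam x)`. -/
def dunklKernel (k lam x : ℝ) : ℂ :=
  (sphericalBessel k (-lam * x) : ℂ) +
    (-Complex.I * lam) * x / (2 * (k + 1)) * (sphericalBessel (k + 1) (-lam * x) : ℂ)

/-- The kernel of the linear canonical Dunkl transform with parameters `M = (a, b; c, d)`,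
`E_k^M(lam, x) = exp((i/2) ((d/b) lam^2 + (a/b) x^2)) E_k(-i lam / b, x)`, used for `b ≠ 0`. -/
def lcdtKernel (k : ℝ) (M : Matrix.SpecialLinearGroup (Fin 2) ℝ) (lam x : ℝ) : ℂ :=
  Complex.exp (Complex.I / 2 *
      (((M 1 1 / M 0 1) * lam ^ 2 + (M 0 0 / M 0 1) * x ^ 2 : ℝ) : ℂ)) *
    dunklKernel k (lam / M 0 1) x

open Classical in
/-- The linear canonical Dunkl transform `D_k^M f` of a `μ_k`-integrable function `f`, where
`M = (a, b; c, d)`. The power of `i b` is the principal one. -/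
def lcdt (k : ℝ) (M : Matrix.SpecialLinearGroup (Fin 2) ℝ) (f : ℝ → ℂ) (lam : ℝ) : ℂ :=
  if M 0 1 = 0 then
    Complex.exp (Complex.I * ((M 1 0 / (2 * M 0 0) * lam ^ 2 : ℝ) : ℂ)) /
      ((|M 0 0| ^ (k + 1) : ℝ) : ℂ) * f (lam / M 0 0)
  else
    1 / (Complex.I * (M 0 1 : ℂ)) ^ ((k + 1 : ℝ) : ℂ) *
      ∫ x, f x * lcdtKernel k M lam x ∂(dunklMeasure k)

/-- `g ∈ L^q_k` is the linear canonical Dunkl transform of `f ∈ L^p_k`, in the sense of extension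
by continuity from the dense subspace `L^1_k ∩ L^p_k`: there are `F n ∈ L^1_k ∩ L^p_k` with
`F n → f` in `L^p_k` and `D_k^M (F n) → g` in `L^q_k`. -/
def IsLCDT (k : ℝ) (M : Matrix.SpecialLinearGroup (Fin 2) ℝ) (p q : ℝ) (f g : ℝ → ℂ) : Prop :=
  MemLp f (ENNReal.ofReal p) (dunklMeasure k) ∧
  MemLp g (ENNReal.ofReal q) (dunklMeasure k) ∧
  ∃ F : ℕ → ℝ → ℂ,
    (∀ n, MemLp (F n) 1 (dunklMeasure k) ∧ MemLp (F n) (ENNReal.ofReal p) (dunklMeasure k)) ∧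
    Tendsto (fun n => eLpNorm (fun x => F n x - f x) (ENNReal.ofReal p) (dunklMeasure k))
      atTop (𝓝 0) ∧
    Tendsto (fun n => eLpNorm (fun x => lcdt k M (F n) x - g x) (ENNReal.ofReal q)
      (dunklMeasure k)) atTop (𝓝 0)

end Dunkl

end

/-!
The chirp factors of `D_k^M` have modulus `1`, so `D_k^M` is, up to unimodular factors, dilations
and constants that depend on `b` and `k` only, the Dunkl transform `F` with kernel `E_k(-i lam, x)`
(`lcdt_eq`). Everything rests on the Hausdorff–Young inequality `‖F f‖_q ≤ C ‖f‖_p`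
(`exists_eLpNorm_dunklTransform_le`), which comes from two endpoint bounds.

* `L¹ → L^∞`: `|E_k(-i lam, x)| ≤ 1`. As `j_k' (z) = -z / (2 (k+1)) * j_{k+1}(z)`, the square of the
  modulus is the energy `u² + u'²` of the solution `u = j_k` of the Bessel equation, which decreases
  on `[0, ∞)` because `k ≥ -1/2` (`sphericalBessel_energy_le`).
* `L² → L²`: `F` maps the Gaussians `x^e exp (-t x²)`, `e = 0, 1`, to Gaussians, and preserves their
  inner products (`integral_transformed_parityGaussian_mul`). Hence it agrees on their span with an
  isometry, whose adjoint yields a candidate for `F f` of norm at most `‖f‖₂`; the multiplication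
  formula and the fact that only `0` is orthogonal to all Gaussians
  (`ae_eq_zero_of_integral_parityGaussian_eq_zero`, by Weierstrass approximation in the variable
  `exp (-x²)`) identify it with `F f` (`eLpNorm_two_dunklTransform_le`).

For exponents in between, Marcinkiewicz interpolation takes a short form at these endpoints
(`lintegral_rpow_le_of_weak_bounds`): at each level the part of `f` that exceeds a threshold
contributes at most half of the level, by the `L^∞` bound. Existence and uniqueness of the
extension to `L^p` follow from Hausdorff–Young.

For the uncertainty inequality, split `g = D_k^M f` at `|lam| = r` and `f` at `|x| = 1 / r`. The
part `|lam| > r` of `g` is at most `r^{-β} ‖|lam|^β g‖_q`. On `|lam| ≤ r`, the outer part of `f`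
contributes at most `C r^α ‖|x|^α f‖_p` by Hausdorff–Young; the inner part has, by Hölder's
inequality and `α q < 2 (k+1)`, an `L¹` norm of order `r^{α - 2(k+1)/q} ‖|x|^α f‖_p`, and the ball
has measure of order `r^{2(k+1)}`, so that it contributes a multiple of `r^α ‖|x|^α f‖_p` as well
(`exists_eLpNorm_le_add`). Optimizing `r` gives the product of powers (`le_mul_rpow_of_forall_le`).
-/

noncomputable section

namespace Dunkl

/-! ### The spherical Bessel function and the bound on the Dunkl kernel -/

/-- The coefficient of `x ^ (2 * n)` in the power series of `sphericalBessel k`. -/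
def besselCoeff (k : ℝ) (n : ℕ) : ℝ :=
  Real.Gamma (k + 1) * (-1) ^ n / 4 ^ n / ((n.factorial : ℝ) * Real.Gamma (n + k + 1))

theorem sphericalBessel_eq_tsum (k x : ℝ) :
    sphericalBessel k x = ∑' n : ℕ, besselCoeff k n * x ^ (2 * n) := by
  rw [sphericalBessel, ← tsum_mul_left]
  refine tsum_congr fun n => ?_
  rw [besselCoeff, div_pow, pow_mul 2]
  norm_num
  ring

theorem gamma_le_two_pow_mul_gamma {k : ℝ} (hk : -(1 / 2 : ℝ) ≤ k) (n : ℕ) :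
    Real.Gamma (k + 1) ≤ 2 ^ n * Real.Gamma (n + k + 1) := by
  induction n with
  | zero => simp
  | succ n ih =>
    have h0 : (0 : ℝ) ≤ n := n.cast_nonneg
    have hpos : 0 < Real.Gamma (n + k + 1) := Real.Gamma_pos_of_pos (by linarith)
    have h1 : Real.Gamma ((n + 1 : ℕ) + k + 1) = (n + k + 1) * Real.Gamma (n + k + 1) := by
      rw [← Real.Gamma_add_one (by linarith)]
      push_cast
      ring_nf
    rw [h1, pow_succ]
    refine ih.trans ?_
    have h2 : 1 * (2 ^ n * Real.Gamma (n + k + 1)) ≤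
        (2 * (n + k + 1)) * (2 ^ n * Real.Gamma (n + k + 1)) :=
      mul_le_mul_of_nonneg_right (by linarith) (by positivity)
    linarith

theorem abs_besselCoeff_le {k : ℝ} (hk : -(1 / 2 : ℝ) ≤ k) (n : ℕ) :
    |besselCoeff k n| ≤ 1 / (n.factorial : ℝ) := by
  have h0 : (0 : ℝ) ≤ n := n.cast_nonneg
  have hpos : 0 < Real.Gamma (n + k + 1) := Real.Gamma_pos_of_pos (by linarith)
  have hpos' : 0 < Real.Gamma (k + 1) := Real.Gamma_pos_of_pos (by linarith)
  have hf : (0 : ℝ) < n.factorial := by positivity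
  rw [besselCoeff, abs_div, abs_div, abs_mul, abs_pow, abs_neg, abs_one, one_pow, mul_one,
    abs_of_pos hpos', abs_of_pos (by positivity : (0 : ℝ) < 4 ^ n),
    abs_of_pos (mul_pos hf hpos), div_div, div_le_div_iff₀ (by positivity) hf]
  have h1 := gamma_le_two_pow_mul_gamma hk n
  have h2 : (2 : ℝ) ^ n ≤ 4 ^ n := pow_le_pow_left₀ (by norm_num) (by norm_num) n
  have h3 : (2 : ℝ) ^ n * Real.Gamma (n + k + 1) ≤ 4 ^ n * Real.Gamma (n + k + 1) :=
    mul_le_mul_of_nonneg_right h2 hpos.le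
  nlinarith

theorem summable_besselCoeff_mul {k : ℝ} (hk : -(1 / 2 : ℝ) ≤ k) (x : ℝ) :
    Summable fun n : ℕ => besselCoeff k n * x ^ (2 * n) := by
  refine Summable.of_norm_bounded (Real.summable_pow_div_factorial (x ^ 2)) fun n => ?_
  rw [Real.norm_eq_abs, abs_mul, pow_mul, abs_of_nonneg (by positivity : 0 ≤ (x ^ 2) ^ n)]
  calc |besselCoeff k n| * (x ^ 2) ^ n ≤ 1 / (n.factorial : ℝ) * (x ^ 2) ^ n :=
        mul_le_mul_of_nonneg_right (abs_besselCoeff_le hk n) (by positivity)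
    _ = _ := by ring

theorem sphericalBessel_zero {k : ℝ} (hk : -(1 / 2 : ℝ) ≤ k) : sphericalBessel k 0 = 1 := by
  have hpos' : 0 < Real.Gamma (k + 1) := Real.Gamma_pos_of_pos (by linarith)
  rw [sphericalBessel_eq_tsum, tsum_eq_single 0]
  · simp [besselCoeff, hpos'.ne']
  · intro n hn
    simp [hn]

theorem sphericalBessel_neg (k x : ℝ) : sphericalBessel k (-x) = sphericalBessel k x := by
  simp only [sphericalBessel_eq_tsum]
  exact tsum_congr fun n => by rw [(even_two_mul n).neg_pow]

theorem hasDerivAt_sphericalBessel_tsum {k : ℝ} (hk : -(1 / 2 : ℝ) ≤ k) (x : ℝ) :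
    HasDerivAt (sphericalBessel k)
      (∑' n : ℕ, besselCoeff k n * ((2 * n : ℕ) * x ^ (2 * n - 1))) x := by
  have h : sphericalBessel k = fun x => ∑' n : ℕ, besselCoeff k n * x ^ (2 * n) :=
    funext (sphericalBessel_eq_tsum k)
  rw [h]
  set R := |x| + 1 with hR
  have hR1 : 1 ≤ R := by simp [hR]
  have hu : Summable fun n : ℕ => 2 * ((2 * R ^ 2) ^ n / (n.factorial : ℝ)) :=
    (Real.summable_pow_div_factorial _).mul_left 2
  refine hasDerivAt_tsum_of_isPreconnected hu (Metric.isOpen_ball (x := (0 : ℝ)) (ε := R))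
    (convex_ball _ _).isPreconnected
    (fun n y _ => (hasDerivAt_pow (2 * n) y).const_mul (besselCoeff k n)) (fun n y hy => ?_)
    (y₀ := x) (by simp [hR]) (summable_besselCoeff_mul hk x) (by simp [hR])
  have hy' : |y| ≤ R := by simpa using (mem_ball_zero_iff.1 hy).le
  rw [Real.norm_eq_abs, abs_mul, abs_mul, abs_pow, Nat.abs_cast]
  have h1 : |y| ^ (2 * n - 1) ≤ R ^ (2 * n) :=
    (pow_le_pow_left₀ (abs_nonneg y) hy' _).trans (pow_le_pow_right₀ hR1 (Nat.sub_le _ _))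
  have h2 : ((2 * n : ℕ) : ℝ) ≤ 2 * 2 ^ n := by
    have := (Nat.lt_two_pow_self (n := n)).le
    exact_mod_cast Nat.mul_le_mul_left 2 this
  calc |besselCoeff k n| * (((2 * n : ℕ) : ℝ) * |y| ^ (2 * n - 1))
      ≤ 1 / (n.factorial : ℝ) * ((2 * 2 ^ n) * R ^ (2 * n)) := by
        gcongr
        exact abs_besselCoeff_le hk n
    _ = _ := by rw [mul_pow, pow_mul R]; ring

theorem besselCoeff_succ {k : ℝ} (hk : -(1 / 2 : ℝ) ≤ k) (n : ℕ) :
    besselCoeff k (n + 1) * (2 * (n + 1)) = -(besselCoeff (k + 1) n / (2 * (k + 1))) := by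
  have h0 : (0 : ℝ) ≤ n := n.cast_nonneg
  have hpos : 0 < Real.Gamma (n + k + 2) := Real.Gamma_pos_of_pos (by linarith)
  have hk1 : k + 1 ≠ 0 := by linarith
  have hf : (n.factorial : ℝ) ≠ 0 := by positivity
  rw [besselCoeff, besselCoeff, Real.Gamma_add_one hk1, Nat.factorial_succ]
  push_cast
  rw [show (n : ℝ) + 1 + k + 1 = n + k + 2 by ring, show (n : ℝ) + (k + 1) + 1 = n + k + 2 by ring]
  field_simp
  ring

theorem besselCoeff_mul_nat {k : ℝ} (hk : -(1 / 2 : ℝ) ≤ k) (n : ℕ) :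
    besselCoeff (k + 1) n * (2 * n) =
      2 * (k + 1) * (besselCoeff k n - besselCoeff (k + 1) n) := by
  have h0 : (0 : ℝ) ≤ n := n.cast_nonneg
  have hpos : 0 < Real.Gamma (n + k + 1) := Real.Gamma_pos_of_pos (by linarith)
  have hk1 : k + 1 ≠ 0 := by linarith
  have hnk : (n : ℝ) + k + 1 ≠ 0 := by linarith
  have hf : (n.factorial : ℝ) ≠ 0 := by positivity
  rw [besselCoeff, besselCoeff, Real.Gamma_add_one hk1,
    show (n : ℝ) + (k + 1) + 1 = (n + k + 1) + 1 by ring, Real.Gamma_add_one hnk]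
  field_simp
  ring

theorem hasDerivAt_sphericalBessel {k : ℝ} (hk : -(1 / 2 : ℝ) ≤ k) (x : ℝ) :
    HasDerivAt (sphericalBessel k) (-(x / (2 * (k + 1))) * sphericalBessel (k + 1) x) x := by
  convert! hasDerivAt_sphericalBessel_tsum hk x using 1
  have hs : ∀ n : ℕ, besselCoeff k (n + 1) * (((2 * (n + 1) : ℕ) : ℝ) * x ^ (2 * (n + 1) - 1)) =
      -(x / (2 * (k + 1))) * (besselCoeff (k + 1) n * x ^ (2 * n)) := fun n => by
    have := besselCoeff_succ hk n
    push_cast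
    rw [← mul_assoc, this, show 2 * (n + 1) - 1 = 2 * n + 1 by lia, pow_succ]
    ring
  rw [tsum_eq_zero_add' (f := fun n : ℕ => besselCoeff k n * (((2 * n : ℕ) : ℝ) * x ^ (2 * n - 1)))]
  · simp_rw [hs, tsum_mul_left, ← sphericalBessel_eq_tsum]
    simp
  · simp_rw [hs]
    exact (summable_besselCoeff_mul (by linarith) x).mul_left _

/-- The contiguity relation `x j_{k+1}'(x) = 2 (k+1) (j_k(x) - j_{k+1}(x))`, stated for whatever
number `u` is the derivative. -/
theorem mul_deriv_sphericalBessel_add_one {k : ℝ} (hk : -(1 / 2 : ℝ) ≤ k) {x u : ℝ}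
    (hu : HasDerivAt (sphericalBessel (k + 1)) u x) :
    x * u = 2 * (k + 1) * (sphericalBessel k x - sphericalBessel (k + 1) x) := by
  rw [hu.unique (hasDerivAt_sphericalBessel_tsum (by linarith) x), ← tsum_mul_left,
    sphericalBessel_eq_tsum, sphericalBessel_eq_tsum,
    ← (summable_besselCoeff_mul hk x).tsum_sub (summable_besselCoeff_mul (by linarith) x),
    ← tsum_mul_left]
  refine tsum_congr fun n => ?_
  rw [← sub_mul, ← mul_assoc (2 * (k + 1)), ← besselCoeff_mul_nat hk]
  rcases n with _ | n
  · simp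
  · rw [show 2 * (n + 1) - 1 = 2 * n + 1 by lia, show 2 * (n + 1) = 2 * n + 1 + 1 by ring,
      pow_succ x (2 * n + 1)]
    push_cast
    ring

theorem continuous_sphericalBessel {k : ℝ} (hk : -(1 / 2 : ℝ) ≤ k) :
    Continuous (sphericalBessel k) :=
  continuous_iff_continuousAt.2 fun x => (hasDerivAt_sphericalBessel hk x).continuousAt

/-- With `u = j_k`, the left side is the energy `u ^ 2 + u' ^ 2` of the Bessel equation
`u'' + (2k+1) / x * u' + u = 0`, which decreases on `[0, ∞)` from the value `1`. -/
theorem sphericalBessel_energy_le {k : ℝ} (hk : -(1 / 2 : ℝ) ≤ k) (x : ℝ) :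
    sphericalBessel k x ^ 2 + (x / (2 * (k + 1)) * sphericalBessel (k + 1) x) ^ 2 ≤ 1 := by
  set A : ℝ → ℝ := fun x =>
    sphericalBessel k x ^ 2 + (x / (2 * (k + 1)) * sphericalBessel (k + 1) x) ^ 2 with hA
  have hk1 : 0 < k + 1 := by linarith
  have hder : ∀ x, HasDerivAt A
      (-(x * sphericalBessel (k + 1) x ^ 2 * (2 * k + 1) / (2 * (k + 1) ^ 2))) x := fun x => by
    have h1 := hasDerivAt_sphericalBessel hk x
    have h2 := hasDerivAt_sphericalBessel (k := k + 1) (by linarith) x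
    have h3 := mul_deriv_sphericalBessel_add_one hk h2
    convert! (h1.pow 2).add ((((hasDerivAt_id x).div_const (2 * (k + 1))).mul h2).pow 2) using 1
    simp only [Pi.mul_apply, id_eq]
    have h4 : x / (2 * (k + 1)) * (-(x / (2 * (k + 1 + 1))) * sphericalBessel (k + 1 + 1) x) =
        sphericalBessel k x - sphericalBessel (k + 1) x := by
      rw [div_mul_eq_mul_div, h3]
      field_simp
    rw [h4]
    have hk2 : 2 * k + 1 = 2 * (k + 1) - 1 := by ring
    rw [hk2]
    generalize sphericalBessel (k + 1) x = v
    generalize sphericalBessel k x = u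
    generalize k + 1 = c at hk1
    have := hk1.ne'
    norm_num
    field_simp
    ring
  have hanti : AntitoneOn A (Set.Ici 0) := by
    refine antitoneOn_of_deriv_nonpos (convex_Ici 0)
      (fun x _ => (hder x).continuousAt.continuousWithinAt)
      (fun x _ => (hder x).differentiableAt.differentiableWithinAt) fun x hx => ?_
    rw [interior_Ici, Set.mem_Ioi] at hx
    rw [(hder x).deriv, neg_nonpos]
    have : 0 ≤ 2 * k + 1 := by linarith
    positivity
  have h0 : A 0 = 1 := by simp [hA, sphericalBessel_zero hk]
  have hpos : ∀ x, 0 ≤ x → A x ≤ 1 := fun x hx => h0 ▸ hanti Set.self_mem_Ici hx hx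
  rcases le_total 0 x with hx | hx
  · exact hpos x hx
  · have := hpos (-x) (by linarith)
    simpa [hA, sphericalBessel_neg, neg_div] using this

theorem dunklKernel_eq (k lam x : ℝ) :
    dunklKernel k lam x = (sphericalBessel k (lam * x) : ℂ) -
      Complex.I * ((lam * x / (2 * (k + 1)) * sphericalBessel (k + 1) (lam * x) : ℝ) : ℂ) := by
  rw [dunklKernel, neg_mul, sphericalBessel_neg, sphericalBessel_neg]
  push_cast
  ring

theorem dunklKernel_comm (k lam x : ℝ) : dunklKernel k lam x = dunklKernel k x lam := by
  rw [dunklKernel_eq, dunklKernel_eq, mul_comm lam]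

theorem norm_dunklKernel_le {k : ℝ} (hk : -(1 / 2 : ℝ) ≤ k) (lam x : ℝ) :
    ‖dunklKernel k lam x‖ ≤ 1 := by
  have h := sphericalBessel_energy_le hk (lam * x)
  have h2 : ‖dunklKernel k lam x‖ ^ 2 ≤ 1 := by
    rw [dunklKernel_eq, Complex.sq_norm, Complex.normSq_apply]
    simp only [Complex.sub_re, Complex.sub_im, Complex.ofReal_re, Complex.ofReal_im,
      Complex.mul_re, Complex.mul_im, Complex.I_re, Complex.I_im]
    linarith
  exact (sq_le_one_iff₀ (norm_nonneg _)).1 h2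

theorem continuous_dunklKernel {k : ℝ} (hk : -(1 / 2 : ℝ) ≤ k) :
    Continuous fun z : ℝ × ℝ => dunklKernel k z.1 z.2 := by
  have h1 := continuous_sphericalBessel hk
  have h2 := continuous_sphericalBessel (k := k + 1) (by linarith)
  simp only [dunklKernel_eq]
  fun_prop

/-! ### The weighted measure -/

/-- The Lebesgue density of `dunklMeasure k`. -/
def dunklDensity (k x : ℝ) : ℝ :=
  |x| ^ (2 * k + 1) / ((2 : ℝ) ^ (k + 1) * Real.Gamma (k + 1))

theorem dunklMeasure_eq (k : ℝ) :
    dunklMeasure k = volume.withDensity fun x => ENNReal.ofReal (dunklDensity k x) := rfl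

theorem dunklDensity_nonneg {k : ℝ} (hk : -(1 / 2 : ℝ) ≤ k) (x : ℝ) : 0 ≤ dunklDensity k x := by
  have : 0 < Real.Gamma (k + 1) := Real.Gamma_pos_of_pos (by linarith)
  unfold dunklDensity
  positivity

theorem continuous_dunklDensity {k : ℝ} (hk : -(1 / 2 : ℝ) ≤ k) : Continuous (dunklDensity k) :=
  (continuous_abs.rpow_const fun _ => Or.inr (by linarith)).div_const _

theorem dunklDensity_mul {k : ℝ} (c x : ℝ) :
    dunklDensity k (c * x) = |c| ^ (2 * k + 1) * dunklDensity k x := by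
  rw [dunklDensity, dunklDensity, abs_mul, Real.mul_rpow (abs_nonneg _) (abs_nonneg _),
    mul_div_assoc]

theorem isLocallyFiniteMeasure_dunklMeasure {k : ℝ} (hk : -(1 / 2 : ℝ) ≤ k) :
    IsLocallyFiniteMeasure (dunklMeasure k) :=
  IsLocallyFiniteMeasure.withDensity_ofReal (continuous_dunklDensity hk)

theorem dunklMeasure_absolutelyContinuous (k : ℝ) : dunklMeasure k ≪ volume :=
  withDensity_absolutelyContinuous _ _

theorem dunklMeasure_singleton (k x : ℝ) : dunklMeasure k {x} = 0 :=
  dunklMeasure_absolutelyContinuous k (measure_singleton x)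

theorem integrable_dunklMeasure_iff {E : Type*} [NormedAddCommGroup E] [NormedSpace ℝ E]
    {k : ℝ} (hk : -(1 / 2 : ℝ) ≤ k) {f : ℝ → E} :
    Integrable f (dunklMeasure k) ↔ Integrable fun x => dunklDensity k x • f x := by
  rw [dunklMeasure_eq, integrable_withDensity_iff_integrable_smul'
    (continuous_dunklDensity hk).measurable.ennreal_ofReal (by simp)]
  simp only [ENNReal.toReal_ofReal (dunklDensity_nonneg hk _)]

theorem integral_dunklMeasure {E : Type*} [NormedAddCommGroup E] [NormedSpace ℝ E]
    {k : ℝ} (hk : -(1 / 2 : ℝ) ≤ k) (f : ℝ → E) :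
    ∫ x, f x ∂dunklMeasure k = ∫ x, dunklDensity k x • f x := by
  rw [dunklMeasure_eq, integral_withDensity_eq_integral_toReal_smul
    (continuous_dunklDensity hk).measurable.ennreal_ofReal (by simp)]
  simp only [ENNReal.toReal_ofReal (dunklDensity_nonneg hk _)]

/-- Homogeneity: dilations rescale `dunklMeasure k` as they rescale Lebesgue measure in
dimension `2 k + 2`. -/
theorem map_mul_dunklMeasure {k : ℝ} (hk : -(1 / 2 : ℝ) ≤ k) {c : ℝ} (hc : c ≠ 0) :
    Measure.map (fun x => c * x) (dunklMeasure k) =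
      ENNReal.ofReal (|c| ^ (-(2 * k + 2))) • dunklMeasure k := by
  have hm : MeasurableEmbedding fun x : ℝ => c * x := measurableEmbedding_mulLeft₀ hc
  have hd : Measurable fun x => ENNReal.ofReal (dunklDensity k x) :=
    (continuous_dunklDensity hk).measurable.ennreal_ofReal
  have hcpos : 0 < |c| := abs_pos.2 hc
  have key : dunklMeasure k = (ENNReal.ofReal (|c| ^ (-(2 * k + 1))) •
      volume.withDensity (fun x => ENNReal.ofReal (dunklDensity k (c * x)))) := by
    have hd' : Measurable fun x => ENNReal.ofReal (dunklDensity k (c * x)) :=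
      hd.comp (measurable_const_mul c)
    rw [← withDensity_smul _ hd', dunklMeasure_eq]
    congr 1
    ext x
    simp only [Pi.smul_apply, smul_eq_mul]
    rw [← ENNReal.ofReal_mul (by positivity), dunklDensity_mul, ← mul_assoc,
      ← Real.rpow_add hcpos]
    simp
  have h2 : Measure.map (fun x => c * x)
      (volume.withDensity (fun x => ENNReal.ofReal (dunklDensity k (c * x)))) =
      ENNReal.ofReal |c|⁻¹ • dunklMeasure k := by
    ext s hs
    rw [hm.map_apply, withDensity_apply _ (hm.measurable hs), ← hm.lintegral_map
      (fun y => ENNReal.ofReal (dunklDensity k y)), ← hm.restrict_map, Real.map_volume_mul_left hc,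
      Measure.restrict_smul, lintegral_smul_measure, Measure.smul_apply, dunklMeasure_eq,
      withDensity_apply _ hs, abs_inv]
  conv_lhs => rw [key]
  rw [Measure.map_smul, h2, smul_smul, ← ENNReal.ofReal_mul (by positivity),
    ← Real.rpow_neg_one |c|, ← Real.rpow_add hcpos]
  congr 3
  ring

theorem lintegral_comp_mul_dunklMeasure {k : ℝ} (hk : -(1 / 2 : ℝ) ≤ k) {c : ℝ} (hc : c ≠ 0)
    (f : ℝ → ENNReal) :
    ∫⁻ x, f (c * x) ∂dunklMeasure k =
      ENNReal.ofReal (|c| ^ (-(2 * k + 2))) * ∫⁻ x, f x ∂dunklMeasure k := by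
  have hm : MeasurableEmbedding fun x : ℝ => c * x := measurableEmbedding_mulLeft₀ hc
  rw [← hm.lintegral_map, map_mul_dunklMeasure hk hc, lintegral_smul_measure, smul_eq_mul]

theorem integral_dunklMeasure_eq_zero_of_odd {k : ℝ} (hk : -(1 / 2 : ℝ) ≤ k) {f : ℝ → ℂ}
    (hf : ∀ x, f (-x) = -f x) : ∫ x, f x ∂dunklMeasure k = 0 := by
  have hm : MeasurableEmbedding fun x : ℝ => (-1) * x :=
    measurableEmbedding_mulLeft₀ (by norm_num)
  have h := hm.integral_map (μ := dunklMeasure k) f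
  rw [map_mul_dunklMeasure hk (by norm_num)] at h
  simp only [neg_mul, one_mul, hf, integral_neg, abs_neg, abs_one, Real.one_rpow,
    ENNReal.ofReal_one, one_smul] at h
  exact self_eq_neg.1 h

theorem integrable_comp_abs_of_integrableOn {f : ℝ → ℝ} (hf : IntegrableOn f (Set.Ioi 0)) :
    Integrable fun x => f |x| := by
  have h1 : IntegrableOn (fun x => f |x|) (Set.Ioi 0) :=
    hf.congr_fun (fun x hx => by rw [abs_of_pos hx]) measurableSet_Ioi
  have h2 : IntegrableOn (fun x => f |x|) (Set.Iic 0) := by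
    rw [← Measure.map_neg_eq_self (volume : Measure ℝ)]
    have m : MeasurableEmbedding fun x : ℝ => -x := (Homeomorph.neg ℝ).measurableEmbedding
    rw [m.integrableOn_map_iff]
    simpa [Function.comp_def, integrableOn_Ici_iff_integrableOn_Ioi] using h1
  rw [← integrableOn_univ, ← Set.Iic_union_Ioi (a := (0 : ℝ))]
  exact h2.union h1

theorem dunklDensity_mul_abs_rpow {k s x : ℝ} (hx : x ∈ Set.Ioi (0 : ℝ)) (y : ℝ) :
    dunklDensity k x * (|x| ^ s * y) =
      ((2 : ℝ) ^ (k + 1) * Real.Gamma (k + 1))⁻¹ * (x ^ (s + 2 * k + 1) * y) := by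
  rw [dunklDensity, abs_of_pos hx, show s + 2 * k + 1 = (2 * k + 1) + s by ring,
    Real.rpow_add hx (2 * k + 1)]
  ring

theorem integrable_abs_rpow_mul_exp {k s t : ℝ} (hk : -(1 / 2 : ℝ) ≤ k) (hs : -(2 * k + 2) < s)
    (ht : 0 < t) : Integrable (fun x => |x| ^ s * Real.exp (-t * x ^ 2)) (dunklMeasure k) := by
  rw [integrable_dunklMeasure_iff hk]
  have h := (integrableOn_rpow_mul_exp_neg_mul_sq ht (s := s + 2 * k + 1) (by linarith)).const_mul
    ((2 : ℝ) ^ (k + 1) * Real.Gamma (k + 1))⁻¹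
  have h' : IntegrableOn (fun x => dunklDensity k x * (|x| ^ s * Real.exp (-t * x ^ 2)))
      (Set.Ioi 0) :=
    IntegrableOn.congr_fun h (fun x hx => (dunklDensity_mul_abs_rpow hx _).symm)
      measurableSet_Ioi
  simpa [dunklDensity] using integrable_comp_abs_of_integrableOn h'

theorem integral_abs_rpow_mul_exp {k s t : ℝ} (hk : -(1 / 2 : ℝ) ≤ k) (hs : -(2 * k + 2) < s)
    (ht : 0 < t) : ∫ x, |x| ^ s * Real.exp (-t * x ^ 2) ∂dunklMeasure k =
      Real.Gamma (s / 2 + k + 1) * t ^ (-(s / 2 + k + 1)) /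
        ((2 : ℝ) ^ (k + 1) * Real.Gamma (k + 1)) := by
  rw [integral_dunklMeasure hk]
  have h := integral_comp_abs
    (f := fun x => dunklDensity k x * (|x| ^ s * Real.exp (-t * x ^ 2)))
  have e : ∀ x, dunklDensity k |x| = dunklDensity k x := fun x => by simp [dunklDensity]
  simp only [abs_abs, sq_abs, e] at h
  have h3 := integral_rpow_mul_exp_neg_mul_rpow (p := 2) (q := s + 2 * k + 1) two_pos
    (by linarith) ht
  simp only [Real.rpow_two] at h3
  simp only [smul_eq_mul]
  rw [h, setIntegral_congr_fun measurableSet_Ioi fun x hx => dunklDensity_mul_abs_rpow hx _,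
    integral_const_mul, h3, show (s + 2 * k + 1 + 1) / 2 = s / 2 + k + 1 by ring,
    show -(s + 2 * k + 1 + 1) / 2 = -(s / 2 + k + 1) by ring]
  ring

theorem integral_sq_mul_dunklMeasure {k : ℝ} (hk : -(1 / 2 : ℝ) ≤ k) (f : ℝ → ℝ) :
    ∫ x, x ^ 2 * f x ∂dunklMeasure k = 2 * (k + 1) * ∫ x, f x ∂dunklMeasure (k + 1) := by
  rw [integral_dunklMeasure hk, integral_dunklMeasure (by linarith), ← integral_const_mul]
  congr 1
  ext x
  have hk1 : k + 1 ≠ 0 := by linarith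
  have hΓ : Real.Gamma (k + 1) ≠ 0 := (Real.Gamma_pos_of_pos (by linarith)).ne'
  have h2 : (2 : ℝ) ^ (k + 1) ≠ 0 := by positivity
  rw [dunklDensity, dunklDensity, Real.Gamma_add_one hk1, Real.rpow_add two_pos (k + 1),
    Real.rpow_one, show 2 * (k + 1) + 1 = (2 * k + 1) + 2 by ring,
    Real.rpow_add_of_nonneg (y := 2 * k + 1) (abs_nonneg x) (by linarith) (by norm_num), Real.rpow_two,
    sq_abs, smul_eq_mul, smul_eq_mul]
  field_simp

theorem measurableSet_abs_le (r : ℝ) : MeasurableSet {x : ℝ | |x| ≤ r} :=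
  measurableSet_le measurable_norm measurable_const

/-- Up to a constant, `|x| ^ (-a)` has the integral `r ^ (2 k + 2 - a)` over `[-r, r]`. -/
theorem exists_setLIntegral_abs_rpow_le {k a : ℝ} (hk : -(1 / 2 : ℝ) ≤ k) (ha : a < 2 * k + 2) :
    ∃ D : ℝ, 0 < D ∧ ∀ r : ℝ, 0 < r →
      ∫⁻ x in {x | |x| ≤ r}, ENNReal.ofReal (|x| ^ (-a)) ∂dunklMeasure k ≤
        ENNReal.ofReal (D * r ^ (2 * k + 2 - a)) := by
  obtain ⟨D, hD, hD1⟩ : ∃ D : ℝ, 0 < D ∧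
      ∫⁻ x in {x | |x| ≤ 1}, ENNReal.ofReal (|x| ^ (-a)) ∂dunklMeasure k ≤ ENNReal.ofReal D := by
    have hint := integrable_abs_rpow_mul_exp (s := -a) (t := 1) hk (by linarith) one_pos
    have hfin := (hint.const_mul (Real.exp 1)).lintegral_lt_top
    refine ⟨(∫⁻ x, ENNReal.ofReal (Real.exp 1 * (|x| ^ (-a) * Real.exp (-1 * x ^ 2)))
      ∂dunklMeasure k).toReal + 1, by positivity, ?_⟩
    refine le_trans ?_ (ENNReal.ofReal_le_ofReal (le_add_of_nonneg_right zero_le_one))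
    rw [ENNReal.ofReal_toReal hfin.ne, ← lintegral_indicator (measurableSet_abs_le 1)]
    refine lintegral_mono fun x => ?_
    refine Set.indicator_apply_le' (fun hx => ?_) fun _ => bot_le
    refine ENNReal.ofReal_le_ofReal ?_
    have hx2 : x ^ 2 ≤ 1 := (sq_le_one_iff_abs_le_one x).2 hx
    have h1 : 1 ≤ Real.exp 1 * Real.exp (-1 * x ^ 2) := by
      rw [← Real.exp_add]
      exact Real.one_le_exp (by linarith)
    calc |x| ^ (-a) = 1 * |x| ^ (-a) := (one_mul _).symm
      _ ≤ (Real.exp 1 * Real.exp (-1 * x ^ 2)) * |x| ^ (-a) := by gcongr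
      _ = _ := by ring
  refine ⟨D, hD, fun r hr => ?_⟩
  have hsc := lintegral_comp_mul_dunklMeasure hk (inv_ne_zero hr.ne')
    ({x : ℝ | |x| ≤ 1}.indicator fun x => ENNReal.ofReal (|x| ^ (-a)))
  have hpt : ∀ x : ℝ, {x : ℝ | |x| ≤ r}.indicator (fun x => ENNReal.ofReal (|x| ^ (-a))) x =
      ENNReal.ofReal (r ^ (-a)) * {x : ℝ | |x| ≤ 1}.indicator
        (fun x => ENNReal.ofReal (|x| ^ (-a))) (r⁻¹ * x) := fun x => by
    have hiff : |r⁻¹ * x| ≤ 1 ↔ |x| ≤ r := by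
      rw [abs_mul, abs_inv, abs_of_pos hr, inv_mul_le_iff₀ hr, mul_one]
    by_cases hx : |x| ≤ r
    · rw [Set.indicator_of_mem (show x ∈ {x : ℝ | |x| ≤ r} from hx),
        Set.indicator_of_mem (show r⁻¹ * x ∈ {x : ℝ | |x| ≤ 1} from hiff.2 hx),
        ← ENNReal.ofReal_mul (by positivity), ← Real.mul_rpow hr.le (abs_nonneg _), abs_mul,
        abs_inv, abs_of_pos hr, mul_inv_cancel_left₀ hr.ne']
    · rw [Set.indicator_of_notMem (show x ∉ {x : ℝ | |x| ≤ r} from hx),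
        Set.indicator_of_notMem (show r⁻¹ * x ∉ {x : ℝ | |x| ≤ 1} from mt hiff.1 hx), mul_zero]
  rw [← lintegral_indicator (measurableSet_abs_le r)]
  simp_rw [hpt]
  rw [lintegral_const_mul' _ _ ENNReal.ofReal_ne_top, hsc, lintegral_indicator (measurableSet_abs_le 1), abs_inv,
    abs_of_pos hr, Real.inv_rpow hr.le, ← Real.rpow_neg hr.le, neg_neg, ← mul_assoc,
    ← ENNReal.ofReal_mul (by positivity), ← Real.rpow_add hr]
  refine (mul_le_mul_right hD1 _).trans ?_
  rw [← ENNReal.ofReal_mul (by positivity), mul_comm D, neg_add_eq_sub]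

/-! ### Gaussians and their transforms -/

/-- The Dunkl transform `F f(lam) = ∫ f(x) E_k(-i lam, x) dμ_k(x)`; the linear canonical Dunkl
transform reduces to it by chirps and dilations. -/
def dunklTransform (k : ℝ) (f : ℝ → ℂ) (lam : ℝ) : ℂ :=
  ∫ x, f x * dunklKernel k lam x ∂dunklMeasure k

/-- The even (`e = 0`) or odd (`e = 1`) Gaussian `x ^ e * exp (-t x ^ 2)`. -/
def parityGaussian (e : Fin 2) (t x : ℝ) : ℝ := x ^ (e : ℕ) * Real.exp (-t * x ^ 2)

theorem continuous_parityGaussian (e : Fin 2) (t : ℝ) : Continuous (parityGaussian e t) := by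
  unfold parityGaussian
  fun_prop

theorem integrable_pow_mul_exp {k t : ℝ} (hk : -(1 / 2 : ℝ) ≤ k) (ht : 0 < t) (n : ℕ) :
    Integrable (fun x => x ^ n * Real.exp (-t * x ^ 2)) (dunklMeasure k) := by
  have h := integrable_abs_rpow_mul_exp (s := n) hk (by
    have : (0 : ℝ) ≤ n := n.cast_nonneg
    linarith) ht
  refine h.mono' (by fun_prop) (ae_of_all _ fun x => ?_)
  rw [norm_mul, norm_pow, Real.norm_eq_abs, Real.norm_of_nonneg (Real.exp_pos _).le,
    Real.rpow_natCast]

theorem integral_pow_two_mul_mul_exp {k t : ℝ} (hk : -(1 / 2 : ℝ) ≤ k) (ht : 0 < t) (n : ℕ) :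
    ∫ x, x ^ (2 * n) * Real.exp (-t * x ^ 2) ∂dunklMeasure k =
      Real.Gamma (n + k + 1) * t ^ (-(n + k + 1)) / ((2 : ℝ) ^ (k + 1) * Real.Gamma (k + 1)) := by
  have h := integral_abs_rpow_mul_exp (s := (2 * n : ℕ)) hk (by
    have : (0 : ℝ) ≤ (2 * n : ℕ) := Nat.cast_nonneg _
    linarith) ht
  simp only [Real.rpow_natCast, (even_two_mul n).pow_abs] at h
  rw [h]
  push_cast
  rw [mul_div_cancel_left₀ _ two_ne_zero]

theorem integral_exp_mul_sphericalBessel {k t : ℝ} (hk : -(1 / 2 : ℝ) ≤ k) (ht : 0 < t)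
    (lam : ℝ) :
    ∫ x, Real.exp (-t * x ^ 2) * sphericalBessel k (lam * x) ∂dunklMeasure k =
      (2 * t) ^ (-(k + 1)) * Real.exp (-(1 / (4 * t)) * lam ^ 2) := by
  set F : ℕ → ℝ → ℝ := fun n x =>
    besselCoeff k n * lam ^ (2 * n) * (x ^ (2 * n) * Real.exp (-t * x ^ 2)) with hF
  have hΓ : 0 < Real.Gamma (k + 1) := Real.Gamma_pos_of_pos (by linarith)
  have hFint : ∀ n, ∫ x, F n x ∂dunklMeasure k =
      (2 * t) ^ (-(k + 1)) * ((-(1 / (4 * t)) * lam ^ 2) ^ n / (n.factorial : ℝ)) := fun n => by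
    have h0 : (0 : ℝ) ≤ n := n.cast_nonneg
    have hΓn : 0 < Real.Gamma (n + k + 1) := Real.Gamma_pos_of_pos (by linarith)
    have htn : t ^ (-(n + k + 1)) = (t ^ n)⁻¹ * t ^ (-(k + 1)) := by
      rw [← Real.rpow_natCast, ← Real.rpow_neg ht.le, ← Real.rpow_add ht]
      ring_nf
    have hpow : (-(1 / (4 * t)) * lam ^ 2) ^ n = (-1) ^ n * lam ^ (2 * n) / (4 ^ n * t ^ n) := by
      rw [mul_pow, ← pow_mul, neg_pow, div_pow, one_pow, mul_pow]
      ring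
    rw [integral_const_mul, integral_pow_two_mul_mul_exp hk ht, htn, besselCoeff, hpow,
      Real.mul_rpow two_pos.le ht.le, Real.rpow_neg two_pos.le]
    have h2 : (0 : ℝ) < 2 ^ (k + 1) := by positivity
    have ht' : 0 < t ^ (-(k + 1)) := by positivity
    field_simp
  have hnorm : ∀ n, ∫ x, ‖F n x‖ ∂dunklMeasure k = ‖∫ x, F n x ∂dunklMeasure k‖ := fun n => by
    have hnn : ∀ x : ℝ, 0 ≤ x ^ (2 * n) * Real.exp (-t * x ^ 2) := fun x =>
      mul_nonneg ((even_two_mul n).pow_nonneg x) (Real.exp_pos _).le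
    simp only [hF, norm_mul _ (_ * Real.exp _), integral_const_mul]
    rw [norm_mul (besselCoeff k n * lam ^ (2 * n)), norm_mul (besselCoeff k n),
      Real.norm_of_nonneg (integral_nonneg hnn)]
    simp only [Real.norm_of_nonneg (hnn _)]
  have hsum : Summable fun n => ∫ x, ‖F n x‖ ∂dunklMeasure k := by
    simp only [hnorm, hFint]
    exact ((Real.summable_pow_div_factorial _).mul_left _).norm
  have key := hasSum_integral_of_summable_integral_norm
    (fun n => (integrable_pow_mul_exp hk ht (2 * n)).const_mul _) hsum
  have hpt : ∀ x, ∑' n, F n x = Real.exp (-t * x ^ 2) * sphericalBessel k (lam * x) := fun x => by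
    rw [sphericalBessel_eq_tsum, ← tsum_mul_left]
    refine tsum_congr fun n => ?_
    rw [hF, mul_pow]
    ring
  have key' : ∑' n, ∫ x, F n x ∂dunklMeasure k = ∫ x, ∑' n, F n x ∂dunklMeasure k := key.tsum_eq
  simp only [hpt] at key'
  rw [← key', Real.exp_eq_exp_ℝ, NormedSpace.exp_eq_tsum_div, ← tsum_mul_left]
  exact tsum_congr hFint

theorem integrable_mul_dunklKernel {k : ℝ} (hk : -(1 / 2 : ℝ) ≤ k) {f : ℝ → ℂ}
    (hf : Integrable f (dunklMeasure k)) (lam : ℝ) :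
    Integrable (fun x => f x * dunklKernel k lam x) (dunklMeasure k) := by
  refine hf.mul_bdd (c := 1) ?_ (ae_of_all _ fun x => norm_dunklKernel_le hk lam x)
  exact ((continuous_dunklKernel hk).comp (Continuous.prodMk_right lam)).aestronglyMeasurable

theorem integrable_parityGaussian {k t : ℝ} (hk : -(1 / 2 : ℝ) ≤ k) (ht : 0 < t) (e : Fin 2) :
    Integrable (fun x => (parityGaussian e t x : ℂ)) (dunklMeasure k) :=
  (integrable_pow_mul_exp hk ht e).ofReal

/-- Gaussians of either parity are carried to multiples of Gaussians of the same parity. -/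
theorem dunklTransform_parityGaussian {k t : ℝ} (hk : -(1 / 2 : ℝ) ≤ k) (ht : 0 < t)
    (e : Fin 2) (lam : ℝ) :
    dunklTransform k (fun x => (parityGaussian e t x : ℂ)) lam =
      (-Complex.I) ^ (e : ℕ) * (((2 * t) ^ (-(k + 1 + (e : ℕ)))
        * parityGaussian e (1 / (4 * t)) lam : ℝ) : ℂ) := by
  have hint := integrable_mul_dunklKernel hk (integrable_parityGaussian hk ht e) lam
  have hk1 : k + 1 ≠ 0 := by linarith
  -- The part of the integrand of the wrong parity integrates to zero.
  have hsplit : ∀ g o : ℝ → ℂ, (∀ x, (parityGaussian e t x : ℂ) * dunklKernel k lam x = g x + o x) →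
      (∀ x, g (-x) = g x) → (∀ x, o (-x) = -o x) →
      dunklTransform k (fun x => (parityGaussian e t x : ℂ)) lam = ∫ x, g x ∂dunklMeasure k := by
    intro g o h hg ho
    have hneg : Integrable (fun x => (parityGaussian e t (-x) : ℂ) * dunklKernel k lam (-x))
        (dunklMeasure k) := by
      have hm : MeasurableEmbedding fun x : ℝ => (-1) * x :=
        measurableEmbedding_mulLeft₀ (by norm_num)
      have := hm.integrable_map_iff (μ := dunklMeasure k)
        (g := fun x => (parityGaussian e t x : ℂ) * dunklKernel k lam x)
      rw [map_mul_dunklMeasure hk (by norm_num)] at this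
      simp only [neg_mul, one_mul, abs_neg, abs_one, Real.one_rpow,
        ENNReal.ofReal_one, one_smul, Function.comp_def] at this
      exact this.1 hint
    have hoi : Integrable o (dunklMeasure k) := by
      refine ((hint.sub hneg).const_mul (1 / 2 : ℂ)).congr (ae_of_all _ fun x => ?_)
      simp only [Pi.sub_apply, h, hg, ho]
      ring
    have hgi : Integrable g (dunklMeasure k) := by
      refine (hint.sub hoi).congr (ae_of_all _ fun x => ?_)
      simp only [Pi.sub_apply, h]
      ring
    rw [dunklTransform]
    simp_rw [h]
    rw [integral_add hgi hoi, integral_dunklMeasure_eq_zero_of_odd hk ho, add_zero]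
  fin_cases e
  · rw [hsplit (fun x => ((Real.exp (-t * x ^ 2) * sphericalBessel k (lam * x) : ℝ) : ℂ))
      (fun x => -(Complex.I * ((Real.exp (-t * x ^ 2) *
        (lam * x / (2 * (k + 1)) * sphericalBessel (k + 1) (lam * x)) : ℝ) : ℂ))),
      integral_complex_ofReal, integral_exp_mul_sphericalBessel hk ht]
    · simp [parityGaussian]
    · intro x
      simp only [parityGaussian, dunklKernel_eq]
      push_cast
      ring
    · intro x
      simp [sphericalBessel_neg]
    · intro x
      simp [sphericalBessel_neg, neg_div]
  · rw [hsplit (fun x => -Complex.I * ((x ^ 2 * (lam / (2 * (k + 1)) * (Real.exp (-t * x ^ 2) *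
        sphericalBessel (k + 1) (lam * x))) : ℝ) : ℂ))
      (fun x => ((x * Real.exp (-t * x ^ 2) * sphericalBessel k (lam * x) : ℝ) : ℂ)),
      integral_const_mul, integral_complex_ofReal, integral_sq_mul_dunklMeasure hk,
      integral_const_mul, integral_exp_mul_sphericalBessel (by linarith) ht]
    · simp only [parityGaussian, Nat.cast_one, pow_one]
      congr 2
      field_simp
    · intro x
      simp only [parityGaussian, dunklKernel_eq, pow_one]
      push_cast
      ring
    · intro x
      simp [sphericalBessel_neg]
    · intro x
      simp [sphericalBessel_neg]

theorem integrable_parityGaussian_mul {k s t : ℝ} (hk : -(1 / 2 : ℝ) ≤ k) (hs : 0 < s)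
    (ht : 0 < t) (e e' : Fin 2) :
    Integrable (fun x => parityGaussian e s x * parityGaussian e' t x) (dunklMeasure k) := by
  refine (integrable_pow_mul_exp hk (add_pos hs ht) (e + e')).congr (ae_of_all _ fun x => ?_)
  simp only [parityGaussian]
  rw [neg_add, add_mul, Real.exp_add, pow_add]
  ring

theorem integral_parityGaussian_mul_of_ne {k s t : ℝ} (hk : -(1 / 2 : ℝ) ≤ k) {e e' : Fin 2}
    (h : e ≠ e') :
    ∫ x, parityGaussian e s x * parityGaussian e' t x ∂dunklMeasure k = 0 := by
  have h0 := integral_dunklMeasure_eq_zero_of_odd hk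
    (f := fun x => ((parityGaussian e s x * parityGaussian e' t x : ℝ) : ℂ)) fun x => by
      fin_cases e <;> fin_cases e' <;> simp [parityGaussian] at h ⊢
  rwa [integral_complex_ofReal, Complex.ofReal_eq_zero] at h0

theorem integral_parityGaussian_mul {k s t : ℝ} (hk : -(1 / 2 : ℝ) ≤ k) (hs : 0 < s)
    (ht : 0 < t) (e : Fin 2) :
    ∫ x, parityGaussian e s x * parityGaussian e t x ∂dunklMeasure k =
      Real.Gamma ((e : ℕ) + k + 1) * (s + t) ^ (-((e : ℕ) + k + 1)) /
        ((2 : ℝ) ^ (k + 1) * Real.Gamma (k + 1)) := by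
  rw [← integral_pow_two_mul_mul_exp hk (add_pos hs ht)]
  congr 1
  ext x
  simp only [parityGaussian]
  rw [neg_add, add_mul, Real.exp_add, two_mul, pow_add]
  ring

/-- The normalized Gaussians `(2t)^{-(k+1+e)} x^e exp(-x²/(4t))`, which the transform makes of the
Gaussians `x^e exp(-t x²)`, have the same Gram matrix as the latter. -/
theorem integral_transformed_parityGaussian_mul {k s t : ℝ} (hk : -(1 / 2 : ℝ) ≤ k) (hs : 0 < s)
    (ht : 0 < t) (e : Fin 2) :
    ∫ x, ((2 * s) ^ (-(k + 1 + (e : ℕ))) * parityGaussian e (1 / (4 * s)) x) *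
        ((2 * t) ^ (-(k + 1 + (e : ℕ))) * parityGaussian e (1 / (4 * t)) x) ∂dunklMeasure k =
      ∫ x, parityGaussian e s x * parityGaussian e t x ∂dunklMeasure k := by
  have h : ∀ a b c d : ℝ, (a * b) * (c * d) = (a * c) * (b * d) := fun a b c d => by ring
  simp_rw [h]
  rw [integral_const_mul, integral_parityGaussian_mul hk (by positivity) (by positivity),
    integral_parityGaussian_mul hk hs ht, ← Real.mul_rpow (by positivity) (by positivity),
    show k + 1 + ((e : ℕ) : ℝ) = (e : ℕ) + k + 1 by ring, mul_div_assoc', mul_left_comm,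
    ← Real.mul_rpow (by positivity) (by positivity),
    show 2 * s * (2 * t) * (1 / (4 * s) + 1 / (4 * t)) = s + t by field_simp; ring]

/-! ### Uniqueness: a function orthogonal to all Gaussians vanishes -/

theorem integral_even_mul_parityGaussian_eq_zero {k : ℝ} {h : ℝ → ℂ} (e : Fin 2)
    (hint : ∀ t : ℝ, 0 < t →
      Integrable (fun x => (parityGaussian e t x : ℂ) * h x) (dunklMeasure k))
    (hzero : ∀ t : ℝ, 0 < t → ∫ x, (parityGaussian e t x : ℂ) * h x ∂dunklMeasure k = 0)
    {a : ℝ → ℝ} (hc : Continuous a) (hs : HasCompactSupport a) (h0 : a 0 = 0)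
    (heven : ∀ x, a (-x) = a x) :
    ∫ x, (a x : ℂ) * ((parityGaussian e 1 x : ℂ) * h x) ∂dunklMeasure k = 0 := by
  -- `a` is a continuous function of `exp (-x ^ 2) ∈ [0, 1]`, hence a uniform limit of polynomials
  -- in it. The value at `0` is right because `Real.log 0 = 0` and `a 0 = 0`.
  set φ : ℝ → ℝ := fun u => a (√(-Real.log u)) with hφ
  have hφa : ∀ x, φ (Real.exp (-x ^ 2)) = a x := fun x => by
    rw [hφ]
    simp only [Real.log_exp, neg_neg, Real.sqrt_sq_eq_abs]
    rcases abs_choice x with h | h <;> rw [h]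
    exact heven x
  have hφc : ContinuousOn φ (Set.Icc 0 1) := by
    intro u hu
    rcases hu.1.eq_or_lt with rfl | hpos
    · have hlim : Tendsto (fun u => √(-Real.log u)) (𝓝[≠] 0) atTop :=
        Real.tendsto_sqrt_atTop.comp (tendsto_neg_atBot_atTop.comp Real.tendsto_log_nhdsNE_zero)
      have hae : ∀ᶠ u in 𝓝[≠] (0 : ℝ), φ u = 0 := by
        obtain ⟨R, hR⟩ := hs.isCompact.isBounded.subset_closedBall 0
        filter_upwards [hlim.eventually_gt_atTop R] with u hu
        refine image_eq_zero_of_notMem_tsupport (f := a) fun hmem => ?_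
        have := mem_closedBall_zero_iff.1 (hR hmem)
        rw [Real.norm_of_nonneg (Real.sqrt_nonneg _)] at this
        linarith
      have hφ0 : φ 0 = 0 := by simp [hφ, h0]
      refine (continuousAt_iff_punctured_nhds.2 ?_).continuousWithinAt
      rw [hφ0]
      exact tendsto_const_nhds.congr' (hae.mono fun u hu => hu.symm)
    · exact (hc.continuousAt.comp (Real.continuous_sqrt.continuousAt.comp
        (Real.continuousAt_log hpos.ne').neg)).continuousWithinAt
  set I := ∫ x, ‖(parityGaussian e 1 x : ℂ) * h x‖ ∂dunklMeasure k with hI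
  have hInn : 0 ≤ I := integral_nonneg fun _ => norm_nonneg _
  have hbdd : ∀ p : Polynomial ℝ, Integrable (fun x => ((p.eval (Real.exp (-x ^ 2)) : ℝ) : ℂ) *
      ((parityGaussian e 1 x : ℂ) * h x)) (dunklMeasure k) ∧
      ∫ x, ((p.eval (Real.exp (-x ^ 2)) : ℝ) : ℂ) *
      ((parityGaussian e 1 x : ℂ) * h x) ∂dunklMeasure k = 0 := fun p => by
    induction p using Polynomial.induction_on' with
    | add p q hp hq =>
      simp only [Polynomial.eval_add, Complex.ofReal_add, add_mul]
      exact ⟨hp.1.add hq.1, by rw [integral_add hp.1 hq.1, hp.2, hq.2, add_zero]⟩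
    | monomial n c =>
      have hpt : ∀ x, ((Polynomial.eval (Real.exp (-x ^ 2)) (Polynomial.monomial n c) : ℝ) : ℂ) *
          ((parityGaussian e 1 x : ℂ) * h x) =
          (c : ℂ) * ((parityGaussian e (n + 1) x : ℂ) * h x) := fun x => by
        rw [Polynomial.eval_monomial, parityGaussian, parityGaussian,
          show -((n : ℝ) + 1) * x ^ 2 = n * (-x ^ 2) + (-1) * x ^ 2 by ring, Real.exp_add,
          Real.exp_nat_mul]
        push_cast
        ring
      simp only [hpt]
      exact ⟨(hint _ (by positivity)).const_mul _, by
        rw [integral_const_mul, hzero _ (by positivity), mul_zero]⟩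
  have haint : Integrable (fun x => (a x : ℂ) * ((parityGaussian e 1 x : ℂ) * h x))
      (dunklMeasure k) := by
    obtain ⟨C, hC⟩ := hc.bounded_above_of_compact_support hs
    refine (hint 1 one_pos).bdd_mul (c := C)
      (Complex.continuous_ofReal.comp hc).aestronglyMeasurable (ae_of_all _ fun x => ?_)
    simpa using hC x
  have hsmall : ∀ ε : ℝ, 0 < ε →
      ‖∫ x, (a x : ℂ) * ((parityGaussian e 1 x : ℂ) * h x) ∂dunklMeasure k‖ ≤ ε * I := by
    intro ε hε
    obtain ⟨p, hp⟩ := exists_polynomial_near_of_continuousOn 0 1 φ hφc ε hε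
    obtain ⟨hpi, hp0⟩ := hbdd p
    rw [← sub_zero (∫ x, _ ∂_), ← hp0, ← integral_sub haint hpi, hI, ← integral_const_mul]
    refine norm_integral_le_of_norm_le ((hint 1 one_pos).norm.const_mul ε)
      (ae_of_all _ fun x => ?_)
    rw [← sub_mul, norm_mul, ← Complex.ofReal_sub, Complex.norm_real]
    refine mul_le_mul_of_nonneg_right ?_ (norm_nonneg _)
    rw [norm_sub_rev, ← hφa x]
    exact (hp _ ⟨(Real.exp_pos _).le, Real.exp_le_one_iff.2 (by nlinarith [sq_nonneg x])⟩).le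
  have hle : ‖∫ x, (a x : ℂ) * ((parityGaussian e 1 x : ℂ) * h x) ∂dunklMeasure k‖ ≤ 0 := by
    have hlim : Tendsto (fun ε : ℝ => ε * I) (𝓝[>] 0) (𝓝 0) := by
      have : Tendsto (fun ε : ℝ => ε * I) (𝓝 0) (𝓝 (0 * I)) := tendsto_id.mul_const I
      rw [zero_mul] at this
      exact this.mono_left nhdsWithin_le_nhds
    exact ge_of_tendsto hlim (eventually_mem_nhdsWithin.mono fun ε hε => hsmall ε hε)
  exact norm_le_zero_iff.1 hle

theorem ae_eq_zero_of_integral_parityGaussian_eq_zero {k : ℝ} (hk : -(1 / 2 : ℝ) ≤ k)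
    {h : ℝ → ℂ}
    (hint : ∀ e t, 0 < t → Integrable (fun x => (parityGaussian e t x : ℂ) * h x) (dunklMeasure k))
    (hzero : ∀ e t, 0 < t → ∫ x, (parityGaussian e t x : ℂ) * h x ∂dunklMeasure k = 0) :
    h =ᵐ[dunklMeasure k] 0 := by
  have := isLocallyFiniteMeasure_dunklMeasure hk
  have hg1 : ∀ x : ℝ, Real.exp (x ^ 2) * Real.exp (-1 * x ^ 2) = 1 := fun x => by
    rw [← Real.exp_add]
    simp
  have hloc : LocallyIntegrable h (dunklMeasure k) := by
    have h1 := (hint 0 1 one_pos).locallyIntegrable.continuous_mul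
      (g := fun x => ((Real.exp (x ^ 2) : ℝ) : ℂ)) (by fun_prop)
    convert h1 using 2 with x
    rw [← mul_assoc, ← Complex.ofReal_mul, parityGaussian, Fin.val_zero, pow_zero, one_mul, hg1,
      Complex.ofReal_one, one_mul]
  have hne : ∀ᵐ x ∂dunklMeasure k, x ≠ 0 := by
    rw [ae_iff]
    simpa using dunklMeasure_singleton k 0
  suffices ∀ᵐ x ∂dunklMeasure k, x ∈ ({0}ᶜ : Set ℝ) → h x = 0 by
    filter_upwards [this, hne] with x h1 h2 using h1 h2
  refine isOpen_compl_singleton.ae_eq_zero_of_integral_contDiff_smul_eq_zero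
    (hloc.locallyIntegrableOn _) fun ψ hψ hψs hψ0 => ?_
  have hψc : Continuous ψ := hψ.continuous
  have hψe : ψ =ᶠ[𝓝 0] 0 := notMem_tsupport_iff_eventuallyEq.1 fun h0 => hψ0 h0 rfl
  have hψe' : ∀ᶠ x in 𝓝 (0 : ℝ), ψ (-x) = 0 := by
    have : Tendsto (fun x : ℝ => -x) (𝓝 0) (𝓝 0) := by
      simpa using (continuous_neg (G := ℝ)).tendsto 0
    exact this.eventually hψe
  have hψs' : HasCompactSupport fun x => ψ (-x) := hψs.comp_homeomorph (Homeomorph.neg ℝ)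
  -- Decomposition of the test function `ψ = (a + x b) exp (-x ^ 2)` with even `a` and `b`.
  set a : ℝ → ℝ := fun x => (ψ x + ψ (-x)) * (Real.exp (x ^ 2) / 2) with ha
  set b : ℝ → ℝ := fun x => (ψ x - ψ (-x)) * (Real.exp (x ^ 2) / (2 * x)) with hb
  have hac : Continuous a := by fun_prop
  have hbc : Continuous b := by
    refine continuous_iff_continuousAt.2 fun x => ?_
    rcases eq_or_ne x 0 with rfl | hx
    · have : b =ᶠ[𝓝 0] fun _ => 0 := by
        filter_upwards [hψe, hψe'] with x h1 h2
        simp only [Pi.zero_apply] at h1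
        simp [hb, h1, h2]
      exact continuousAt_const.congr this.symm
    · have h2x : 2 * x ≠ 0 := by simpa using hx
      have h2 : ContinuousAt (fun x : ℝ => Real.exp (x ^ 2) / (2 * x)) x :=
        ContinuousAt.div (by fun_prop) (by fun_prop) h2x
      exact ContinuousAt.mul (by fun_prop) h2
  have h0 : ψ 0 = 0 := hψe.self_of_nhds
  have hA := integral_even_mul_parityGaussian_eq_zero 0 (hint 0) (hzero 0) hac
    ((hψs.add hψs').mul_right) (by simp [ha, h0]) fun x => by simp [ha, add_comm]
  have hB := integral_even_mul_parityGaussian_eq_zero 1 (hint 1) (hzero 1) hbc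
    ((hψs.sub hψs').mul_right) (by simp [hb]) fun x => by
      simp only [hb, neg_neg, neg_sq, mul_neg, div_neg]
      ring
  have hi : ∀ (c : ℝ → ℝ) (e : Fin 2), Continuous c → HasCompactSupport c →
      Integrable (fun x => (c x : ℂ) * ((parityGaussian e 1 x : ℂ) * h x))
      (dunklMeasure k) := fun c e hc hs => by
    obtain ⟨C, hC⟩ := hc.bounded_above_of_compact_support hs
    refine (hint e 1 one_pos).bdd_mul (c := C)
      (Complex.continuous_ofReal.comp hc).aestronglyMeasurable (ae_of_all _ fun x => ?_)
    simpa using hC x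
  have hadd := integral_add (hi a 0 hac (hψs.add hψs').mul_right)
    (hi b 1 hbc (hψs.sub hψs').mul_right)
  rw [hA, hB, add_zero] at hadd
  rw [← hadd]
  refine integral_congr_ae (hne.mono fun x hx => ?_)
  have hψx : ψ x = a x * parityGaussian 0 1 x + b x * parityGaussian 1 1 x := by
    simp only [ha, hb, parityGaussian, Fin.val_zero, pow_zero, one_mul, Fin.val_one, pow_one]
    have e1 := hg1 x
    rw [neg_one_mul] at e1
    have : ψ x = ψ x * (Real.exp (x ^ 2) * Real.exp (-x ^ 2)) := by rw [e1, mul_one]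
    rw [neg_one_mul]
    conv_lhs => rw [this]
    field_simp
    ring
  simp only [Complex.real_smul, hψx]
  push_cast
  ring

/-! ### The transform is a contraction of `L²` -/

/-- If the families `v` and `w` have the same Gram matrix, then `v i ↦ w i` extends to an isometry
of the spans; its adjoint provides, for each `f`, a vector `G` with `⟪v i, G⟫ = ⟪w i, f⟫`. -/
theorem exists_inner_eq_of_gram_eq {ι H : Type*} [NormedAddCommGroup H] [InnerProductSpace ℂ H]
    [CompleteSpace H] {v w : ι → H} (hvw : ∀ i j, inner ℂ (v i) (v j) = inner ℂ (w i) (w j))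
    (f : H) : ∃ G : H, ‖G‖ ≤ ‖f‖ ∧ ∀ i, inner ℂ (v i) G = inner ℂ (w i) f := by
  set lv := Finsupp.linearCombination ℂ v
  set lw := Finsupp.linearCombination ℂ w
  have hnorm : ∀ c, ‖lw c‖ = ‖lv c‖ := fun c => by
    have : inner ℂ (lw c) (lw c) = inner ℂ (lv c) (lv c) := by
      simp only [lv, lw, Finsupp.linearCombination_apply, Finsupp.sum, sum_inner, inner_sum,
        inner_smul_left, inner_smul_right, hvw]
    rw [inner_self_eq_norm_sq_to_K, inner_self_eq_norm_sq_to_K] at this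
    have h2 : ‖lw c‖ ^ 2 = ‖lv c‖ ^ 2 := by exact_mod_cast this
    exact (pow_left_inj₀ (norm_nonneg _) (norm_nonneg _) two_ne_zero).1 h2
  obtain ⟨s, hs⟩ := lv.rangeRestrict.exists_rightInverse_of_surjective lv.range_rangeRestrict
  have hs' : ∀ y : LinearMap.range lv, lv (s y) = y := fun y =>
    congrArg Subtype.val (LinearMap.congr_fun hs y)
  let ℓ : LinearMap.range lv →ₗ[ℂ] ℂ := (innerSL ℂ f).toLinearMap ∘ₗ lw ∘ₗ s
  have hℓ : ∀ y, ‖ℓ y‖ ≤ ‖f‖ * ‖y‖ := fun y => by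
    refine (norm_inner_le_norm f (lw (s y))).trans_eq ?_
    rw [hnorm, hs']
    rfl
  obtain ⟨L, hL, hLn⟩ := exists_extension_norm_eq _ (ℓ.mkContinuous ‖f‖ hℓ)
  refine ⟨(InnerProductSpace.toDual ℂ H).symm L, ?_, fun i => ?_⟩
  · rw [LinearIsometryEquiv.norm_map, hLn]
    exact LinearMap.mkContinuous_norm_le _ (norm_nonneg _) _
  · rw [← inner_conj_symm, InnerProductSpace.toDual_symm_apply, ← inner_conj_symm (w i)]
    have hmem : v i ∈ LinearMap.range lv := ⟨Finsupp.single i 1, by simp [lv]⟩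
    have h1 := hL ⟨v i, hmem⟩
    simp only [LinearMap.mkContinuous_apply] at h1
    have h2 : lw (s ⟨v i, hmem⟩) = w i := by
      have h3 : lw (s ⟨v i, hmem⟩ - Finsupp.single i 1) = 0 := by
        rw [← norm_eq_zero, hnorm, map_sub, hs', norm_eq_zero]
        simp [lv]
      rw [map_sub, sub_eq_zero] at h3
      rw [h3]
      simp [lw]
    rw [h1, show ℓ ⟨v i, hmem⟩ = inner ℂ f (lw (s ⟨v i, hmem⟩)) from rfl, h2]

theorem continuous_dunklTransform {k : ℝ} (hk : -(1 / 2 : ℝ) ≤ k) {f : ℝ → ℂ}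
    (hf : Integrable f (dunklMeasure k)) : Continuous (dunklTransform k f) := by
  refine continuous_of_dominated (bound := fun x => ‖f x‖)
    (fun lam => (integrable_mul_dunklKernel hk hf lam).aestronglyMeasurable)
    (fun lam => ae_of_all _ fun x => ?_) hf.norm (ae_of_all _ fun x => ?_)
  · rw [norm_mul]
    exact mul_le_of_le_one_right (norm_nonneg _) (norm_dunklKernel_le hk lam x)
  · exact continuous_const.mul ((continuous_dunklKernel hk).comp (Continuous.prodMk_left x))

theorem enorm_dunklTransform_le {k : ℝ} (hk : -(1 / 2 : ℝ) ≤ k) (f : ℝ → ℂ) (lam : ℝ) :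
    ‖dunklTransform k f lam‖ₑ ≤ ∫⁻ x, ‖f x‖ₑ ∂dunklMeasure k := by
  refine (enorm_integral_le_lintegral_enorm _).trans (lintegral_mono fun x => ?_)
  rw [enorm_mul]
  refine mul_le_of_le_one_right bot_le ?_
  rw [← ofReal_norm]
  exact ENNReal.ofReal_le_one.2 (norm_dunklKernel_le hk lam x)

/-- The multiplication formula `∫ f · F g = ∫ F f · g`, by Fubini and the symmetry of the kernel. -/
theorem integral_mul_dunklTransform {k : ℝ} (hk : -(1 / 2 : ℝ) ≤ k) {f g : ℝ → ℂ}
    (hf : Integrable f (dunklMeasure k)) (hg : Integrable g (dunklMeasure k)) :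
    ∫ x, f x * dunklTransform k g x ∂dunklMeasure k =
      ∫ x, g x * dunklTransform k f x ∂dunklMeasure k := by
  have := isLocallyFiniteMeasure_dunklMeasure hk
  simp only [dunklTransform, ← integral_const_mul]
  rw [integral_integral_swap]
  · refine integral_congr_ae (ae_of_all _ fun y => ?_)
    refine integral_congr_ae (ae_of_all _ fun x => ?_)
    simp only [dunklKernel_comm k x y]
    ring
  · have h1 := (hf.mul_prod hg).mul_bdd (c := 1)
      (continuous_dunklKernel hk).aestronglyMeasurable
      (ae_of_all _ fun z => norm_dunklKernel_le hk z.1 z.2)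
    exact h1.congr (ae_of_all _ fun z => by simp [Function.uncurry, mul_assoc])

/-- The `L²` bound. Gaussians and their transforms have equal Gram matrices, so there is `G` with
`‖G‖₂ ≤ ‖f‖₂` and `∫ φ G = ∫ F φ · f` for all Gaussians `φ`; by the multiplication formula and
uniqueness, `G` is the transform of `f`. -/
theorem eLpNorm_two_dunklTransform_le {k : ℝ} (hk : -(1 / 2 : ℝ) ≤ k) {f : ℝ → ℂ}
    (hf1 : Integrable f (dunklMeasure k)) (hf2 : MemLp f 2 (dunklMeasure k)) :
    eLpNorm (dunklTransform k f) 2 (dunklMeasure k) ≤ eLpNorm f 2 (dunklMeasure k) := by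
  have hg2 : ∀ (e : Fin 2) (t : ℝ), 0 < t → MemLp (parityGaussian e t) 2 (dunklMeasure k) :=
    fun e t ht => by
      rw [memLp_two_iff_integrable_sq (continuous_parityGaussian e t).aestronglyMeasurable]
      simpa only [sq] using integrable_parityGaussian_mul hk ht ht e e
  have hgc : ∀ i : Fin 2 × Set.Ioi (0 : ℝ),
      MemLp (fun x => (parityGaussian i.1 i.2 x : ℂ)) 2 (dunklMeasure k) :=
    fun i => (hg2 i.1 i.2 i.2.2).ofReal
  -- The complex conjugates of the transforms of the Gaussians.
  set W : Fin 2 × Set.Ioi (0 : ℝ) → ℝ → ℂ := fun i x => Complex.I ^ (i.1 : ℕ) *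
    (((2 * (i.2 : ℝ)) ^ (-(k + 1 + (i.1 : ℕ))) *
      parityGaussian i.1 (1 / (4 * (i.2 : ℝ))) x : ℝ) : ℂ)
    with hW
  have hWm : ∀ i, MemLp (W i) 2 (dunklMeasure k) := fun i => by
    have hi : 0 < (i.2 : ℝ) := i.2.2
    exact (((hg2 i.1 (1 / (4 * (i.2 : ℝ))) (by positivity)).const_mul _).ofReal).const_mul _
  have hWt : ∀ i x, starRingEnd ℂ (W i x) =
      dunklTransform k (fun x => (parityGaussian i.1 i.2 x : ℂ)) x := fun i x => by
    rw [dunklTransform_parityGaussian hk i.2.2]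
    simp only [hW, map_mul, map_pow, Complex.conj_I, Complex.conj_ofReal]
  have hgram : ∀ i j, inner ℂ ((hgc i).toLp _) ((hgc j).toLp _) =
      inner ℂ ((hWm i).toLp _) ((hWm j).toLp _) := fun i j => by
    rw [L2.inner_def, L2.inner_def]
    have h1 : ∫ x, inner ℂ ((hgc i).toLp _ x) ((hgc j).toLp _ x) ∂dunklMeasure k =
        ((∫ x, parityGaussian i.1 i.2 x * parityGaussian j.1 j.2 x ∂dunklMeasure k : ℝ) : ℂ) := by
      rw [← integral_complex_ofReal]
      refine integral_congr_ae ?_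
      filter_upwards [(hgc i).coeFn_toLp, (hgc j).coeFn_toLp] with x hx hy
      rw [hx, hy, RCLike.inner_apply, Complex.conj_ofReal]
      push_cast
      ring
    have h2 : ∫ x, inner ℂ ((hWm i).toLp _ x) ((hWm j).toLp _ x) ∂dunklMeasure k =
        ((-Complex.I) ^ (i.1 : ℕ) * Complex.I ^ (j.1 : ℕ)) *
        ((∫ x, ((2 * (i.2 : ℝ)) ^ (-(k + 1 + (i.1 : ℕ))) *
          parityGaussian i.1 (1 / (4 * (i.2 : ℝ))) x) * ((2 * (j.2 : ℝ)) ^ (-(k + 1 + (j.1 : ℕ))) *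
          parityGaussian j.1 (1 / (4 * (j.2 : ℝ))) x) ∂dunklMeasure k : ℝ) : ℂ) := by
      rw [← integral_complex_ofReal, ← integral_const_mul]
      refine integral_congr_ae ?_
      filter_upwards [(hWm i).coeFn_toLp, (hWm j).coeFn_toLp] with x hx hy
      rw [hx, hy, RCLike.inner_apply]
      simp only [hW, map_mul, map_pow, Complex.conj_I, Complex.conj_ofReal]
      push_cast
      ring
    rw [h1, h2]
    obtain ⟨e, s, hs⟩ := i
    obtain ⟨e', t, ht⟩ := j
    by_cases he : e = e'
    · subst he
      rw [integral_transformed_parityGaussian_mul hk hs ht, ← mul_pow]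
      simp
    · have hz : ∀ a b c d : ℝ, (a * b) * (c * d) = (a * c) * (b * d) := fun a b c d => by ring
      simp_rw [hz]
      rw [integral_const_mul, integral_parityGaussian_mul_of_ne hk he,
        integral_parityGaussian_mul_of_ne hk he]
      simp
  obtain ⟨G, hGn, hG⟩ := exists_inner_eq_of_gram_eq hgram (hf2.toLp f)
  have hFm : AEStronglyMeasurable (dunklTransform k f) (dunklMeasure k) :=
    (continuous_dunklTransform hk hf1).aestronglyMeasurable
  have hFbdd : ∀ x, ‖dunklTransform k f x‖ ≤ ∫ x, ‖f x‖ ∂dunklMeasure k := fun x => by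
    refine norm_integral_le_of_norm_le hf1.norm (ae_of_all _ fun y => ?_)
    rw [norm_mul]
    exact mul_le_of_le_one_right (norm_nonneg _) (norm_dunklKernel_le hk x y)
  have hgF : ∀ (e : Fin 2) (t : ℝ), 0 < t →
      Integrable (fun x => (parityGaussian e t x : ℂ) * dunklTransform k f x) (dunklMeasure k) :=
    fun e t ht => (integrable_parityGaussian hk ht e).mul_bdd hFm (ae_of_all _ hFbdd)
  have hgG : ∀ (e : Fin 2) (t : ℝ), 0 < t →
      Integrable (fun x => (parityGaussian e t x : ℂ) * G x) (dunklMeasure k) :=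
    fun e t ht => (hgc (e, ⟨t, ht⟩)).integrable_mul (Lp.memLp G)
  have hzero : (fun x => dunklTransform k f x - G x) =ᵐ[dunklMeasure k] 0 := by
    refine ae_eq_zero_of_integral_parityGaussian_eq_zero hk (fun e t ht => ?_) fun e t ht => ?_
    · simp only [mul_sub]
      exact (hgF e t ht).sub (hgG e t ht)
    · simp only [mul_sub]
      rw [integral_sub (hgF e t ht) (hgG e t ht), sub_eq_zero,
        integral_mul_dunklTransform hk (integrable_parityGaussian hk ht e) hf1]
      have h1 := hG (e, ⟨t, ht⟩)
      rw [L2.inner_def, L2.inner_def] at h1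
      have h2 : ∫ x, inner ℂ ((hgc (e, ⟨t, ht⟩)).toLp _ x) (G x) ∂dunklMeasure k =
          ∫ x, (parityGaussian e t x : ℂ) * G x ∂dunklMeasure k := by
        refine integral_congr_ae ?_
        filter_upwards [(hgc (e, ⟨t, ht⟩)).coeFn_toLp] with x hx
        rw [hx, RCLike.inner_apply, Complex.conj_ofReal, mul_comm]
      have h3 : ∫ x, inner ℂ ((hWm (e, ⟨t, ht⟩)).toLp _ x) (hf2.toLp f x) ∂dunklMeasure k =
          ∫ x, f x * dunklTransform k (fun x => (parityGaussian e t x : ℂ)) x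
            ∂dunklMeasure k := by
        refine integral_congr_ae ?_
        filter_upwards [(hWm (e, ⟨t, ht⟩)).coeFn_toLp, hf2.coeFn_toLp] with x hx hy
        rw [hx, hy, RCLike.inner_apply, hWt]
      rw [← h2, h1, h3]
  have hae : dunklTransform k f =ᵐ[dunklMeasure k] G :=
    hzero.mono fun x hx => sub_eq_zero.1 hx
  rw [eLpNorm_congr_ae hae, ← Lp.enorm_def, ← ofReal_norm]
  refine (ENNReal.ofReal_le_ofReal hGn).trans_eq ?_
  rw [ofReal_norm, Lp.enorm_toLp]

/-! ### Interpolation between `L¹ → L^∞` and `L² → L²` -/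

theorem eLpNorm_ofReal_eq {α : Type*} [MeasurableSpace α] {μ : Measure α} {p : ℝ} (hp : 0 < p)
    (f : α → ℂ) :
    eLpNorm f (ENNReal.ofReal p) μ = (∫⁻ x, ‖f x‖ₑ ^ p ∂μ) ^ (1 / p) := by
  rw [eLpNorm_eq_lintegral_rpow_enorm_toReal (by simpa using hp) ENNReal.ofReal_ne_top,
    ENNReal.toReal_ofReal hp.le]

/-- The tail estimate of Marcinkiewicz interpolation: `f` is split along
`s * ‖f‖ ^ (p - 1) ≤ 2 * A` with `A = ∫ ‖f‖ ^ p`, so that the transform of the large part, being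
at most its `L¹` norm, is at most `s / 2`. -/
theorem meas_lt_norm_le_of_weak_bounds {α : Type*} [MeasurableSpace α] {μ : Measure α}
    {T : (α → ℂ) → α → ℂ}
    (hadd : ∀ f g, Integrable f μ → Integrable g μ → ∀ x, T (f + g) x = T f x + T g x)
    (hmeas : ∀ f, Integrable f μ → AEStronglyMeasurable (T f) μ)
    (h1 : ∀ f, Integrable f μ → ∀ x, ‖T f x‖ₑ ≤ ∫⁻ y, ‖f y‖ₑ ∂μ)
    (h2 : ∀ f, Integrable f μ → ∫⁻ x, ‖T f x‖ₑ ^ (2 : ℝ) ∂μ ≤ ∫⁻ x, ‖f x‖ₑ ^ (2 : ℝ) ∂μ)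
    {f : α → ℂ} (hf : Integrable f μ) (hfm : StronglyMeasurable f) {p A s : ℝ} (hp : 1 < p)
    (hA : 0 < A) (hfA : ∫⁻ x, ‖f x‖ₑ ^ p ∂μ = ENNReal.ofReal A) (hs : 0 < s) :
    μ {x | s < ‖T f x‖} ≤ ENNReal.ofReal (4 / s ^ 2) *
      ∫⁻ x in {x | s * ‖f x‖ ^ (p - 1) ≤ 2 * A}, ‖f x‖ₑ ^ (2 : ℝ) ∂μ := by
  set E : Set α := {x | s * ‖f x‖ ^ (p - 1) ≤ 2 * A} with hE
  have hEm : MeasurableSet E :=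
    measurableSet_le ((hfm.measurable.norm.pow_const _).const_mul _) measurable_const
  set f1 := Eᶜ.indicator f with hf1
  set f2 := E.indicator f with hf2
  have hi1 : Integrable f1 μ := hf.indicator hEm.compl
  have hi2 : Integrable f2 μ := hf.indicator hEm
  have hsum : f1 + f2 = f := Set.indicator_compl_add_self E f
  have hlarge : ∫⁻ y, ‖f1 y‖ₑ ∂μ ≤ ENNReal.ofReal (s / 2) := by
    calc ∫⁻ y, ‖f1 y‖ₑ ∂μ ≤ ∫⁻ y, ENNReal.ofReal (s / (2 * A)) * ‖f y‖ₑ ^ p ∂μ := by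
          refine lintegral_mono fun y => ?_
          by_cases hy : y ∈ E
          · simp [hf1, hy]
          · have hy' : 2 * A < s * ‖f y‖ ^ (p - 1) := not_le.1 hy
            have hfy : 0 < ‖f y‖ := by
              rcases (norm_nonneg (f y)).eq_or_lt with h | h
              · rw [← h, Real.zero_rpow (by linarith)] at hy'
                linarith
              · exact h
            rw [hf1, Set.indicator_of_mem hy, ← ofReal_norm,
              ENNReal.ofReal_rpow_of_pos hfy, ← ENNReal.ofReal_mul (by positivity)]
            refine ENNReal.ofReal_le_ofReal ?_
            have hpow : ‖f y‖ ^ p = ‖f y‖ * ‖f y‖ ^ (p - 1) := by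
              rw [Real.rpow_sub_one hfy.ne']
              field_simp
            rw [hpow, div_mul_eq_mul_div, le_div_iff₀ (by positivity)]
            nlinarith
      _ = ENNReal.ofReal (s / 2) := by
          rw [lintegral_const_mul' _ _ ENNReal.ofReal_ne_top, hfA,
            ← ENNReal.ofReal_mul (by positivity)]
          congr 1
          field_simp
  have hsub : {x | s < ‖T f x‖} ⊆ {x | ENNReal.ofReal (s / 2) ^ (2 : ℝ) ≤ ‖T f2 x‖ₑ ^ (2 : ℝ)} := by
    intro x hx
    have hx1 : ‖T f1 x‖ ≤ s / 2 := by
      have := (h1 f1 hi1 x).trans hlarge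
      rw [← ofReal_norm] at this
      exact (ENNReal.ofReal_le_ofReal_iff (by positivity)).1 this
    have hx2 : T f x = T f1 x + T f2 x := by rw [← hadd f1 f2 hi1 hi2, hsum]
    have hx3 : s < ‖T f1 x + T f2 x‖ := hx2 ▸ hx
    have hx4 : s / 2 ≤ ‖T f2 x‖ := by linarith [norm_add_le (T f1 x) (T f2 x)]
    refine ENNReal.rpow_le_rpow ?_ two_pos.le
    rw [← ofReal_norm]
    exact ENNReal.ofReal_le_ofReal hx4
  have hcheb := mul_meas_ge_le_lintegral₀ ((hmeas f2 hi2).enorm.pow_const (2 : ℝ))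
    (ENNReal.ofReal (s / 2) ^ (2 : ℝ))
  have h2' : ∫⁻ x, ‖T f2 x‖ₑ ^ (2 : ℝ) ∂μ ≤ ∫⁻ x in E, ‖f x‖ₑ ^ (2 : ℝ) ∂μ := by
    refine (h2 f2 hi2).trans_eq ?_
    rw [← lintegral_indicator hEm]
    refine lintegral_congr fun x => ?_
    by_cases hx : x ∈ E <;> simp [hf2, hx]
  have hc : ENNReal.ofReal (4 / s ^ 2) * ENNReal.ofReal (s / 2) ^ (2 : ℝ) = 1 := by
    rw [ENNReal.ofReal_rpow_of_pos (by positivity), ← ENNReal.ofReal_mul (by positivity),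
      Real.rpow_two, show 4 / s ^ 2 * (s / 2) ^ 2 = 1 by field_simp; norm_num,
      ENNReal.ofReal_one]
  calc μ {x | s < ‖T f x‖}
      ≤ μ {x | ENNReal.ofReal (s / 2) ^ (2 : ℝ) ≤ ‖T f2 x‖ₑ ^ (2 : ℝ)} := measure_mono hsub
    _ = ENNReal.ofReal (4 / s ^ 2) * (ENNReal.ofReal (s / 2) ^ (2 : ℝ) *
        μ {x | ENNReal.ofReal (s / 2) ^ (2 : ℝ) ≤ ‖T f2 x‖ₑ ^ (2 : ℝ)}) := by
        rw [← mul_assoc, hc, one_mul]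
    _ ≤ _ := by gcongr; exact hcheb.trans h2'

theorem setLIntegral_rpow_Ioc {q B : ℝ} (hq : 2 < q) (hB : 0 ≤ B) :
    ∫⁻ s in Set.Ioc 0 B, ENNReal.ofReal (s ^ (q - 3)) = ENNReal.ofReal (B ^ (q - 2) / (q - 2)) := by
  have hi : IntervalIntegrable (fun s : ℝ => s ^ (q - 3)) volume 0 B :=
    intervalIntegral.intervalIntegrable_rpow' (by linarith)
  rw [← ofReal_integral_eq_lintegral_ofReal
    ((intervalIntegrable_iff_integrableOn_Ioc_of_le hB).1 hi)
    ((ae_restrict_mem measurableSet_Ioc).mono fun s hs => Real.rpow_nonneg hs.1.le _),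
    ← intervalIntegral.integral_of_le hB, integral_rpow (Or.inl (by linarith)),
    show q - 3 + 1 = q - 2 by ring, Real.zero_rpow (by linarith), sub_zero]

/-- Marcinkiewicz interpolation at the exponents `(1, ∞)` and `(2, 2)`, for `2 < q`. -/
theorem lintegral_rpow_le_of_weak_bounds {α : Type*} [MeasurableSpace α] {μ : Measure α}
    [SFinite μ] {T : (α → ℂ) → α → ℂ}
    (hadd : ∀ f g, Integrable f μ → Integrable g μ → ∀ x, T (f + g) x = T f x + T g x)
    (hmeas : ∀ f, Integrable f μ → AEStronglyMeasurable (T f) μ)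
    (h1 : ∀ f, Integrable f μ → ∀ x, ‖T f x‖ₑ ≤ ∫⁻ y, ‖f y‖ₑ ∂μ)
    (h2 : ∀ f, Integrable f μ → ∫⁻ x, ‖T f x‖ₑ ^ (2 : ℝ) ∂μ ≤ ∫⁻ x, ‖f x‖ₑ ^ (2 : ℝ) ∂μ)
    {f : α → ℂ} (hf : Integrable f μ) (hfm : StronglyMeasurable f) {p q A : ℝ} (hp : 1 < p)
    (hpq : p.HolderConjugate q) (hq : 2 < q)
    (hA : 0 < A) (hfA : ∫⁻ x, ‖f x‖ₑ ^ p ∂μ = ENNReal.ofReal A) :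
    ∫⁻ x, ‖T f x‖ₑ ^ q ∂μ ≤ ENNReal.ofReal (q * 4 * 2 ^ (q - 2) / (q - 2) * A ^ (q - 1)) := by
  have hq0 : 0 < q := by linarith
  have hlc := lintegral_rpow_eq_lintegral_meas_lt_mul μ (f := fun x => ‖T f x‖)
    (ae_of_all _ fun x => norm_nonneg _) (hmeas f hf).norm.aemeasurable hq0
  have hlhs : ∫⁻ x, ‖T f x‖ₑ ^ q ∂μ = ∫⁻ x, ENNReal.ofReal (‖T f x‖ ^ q) ∂μ :=
    lintegral_congr fun x => by
      rw [← ofReal_norm, ENNReal.ofReal_rpow_of_nonneg (norm_nonneg _) hq0.le]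
  set E : ℝ → Set α := fun s => {x | s * ‖f x‖ ^ (p - 1) ≤ 2 * A} with hE
  have hEm : ∀ s, MeasurableSet (E s) := fun s =>
    measurableSet_le ((hfm.measurable.norm.pow_const _).const_mul _) measurable_const
  set Q : Set (ℝ × α) := {z | z.1 * ‖f z.2‖ ^ (p - 1) ≤ 2 * A} with hQ
  have hQm : MeasurableSet Q := by
    refine measurableSet_le (measurable_fst.mul ?_) measurable_const
    exact (hfm.measurable.norm.pow_const _).comp measurable_snd
  set Φ : ℝ → α → ENNReal := fun s x =>
    Q.indicator (fun z => ENNReal.ofReal (4 * z.1 ^ (q - 3)) * ‖f z.2‖ₑ ^ (2 : ℝ)) (s, x) with hΦ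
  have hΦm : Measurable (Function.uncurry Φ) := by
    refine Measurable.indicator ?_ hQm
    refine ((measurable_fst.pow_const _).const_mul _).ennreal_ofReal.mul ?_
    exact (hfm.enorm.pow_const _).comp measurable_snd
  have hbound : ∀ s ∈ Set.Ioi (0 : ℝ), μ {x | s < ‖T f x‖} * ENNReal.ofReal (s ^ (q - 1)) ≤
      ∫⁻ x, Φ s x ∂μ := by
    intro s hs
    have hs0 : 0 < s := hs
    have hΦs : ∀ x, Φ s x =
        (E s).indicator (fun x => ENNReal.ofReal (4 * s ^ (q - 3)) * ‖f x‖ₑ ^ (2 : ℝ)) x :=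
      fun x => rfl
    simp_rw [hΦs]
    rw [lintegral_indicator (hEm s), lintegral_const_mul' _ _ ENNReal.ofReal_ne_top]
    calc μ {x | s < ‖T f x‖} * ENNReal.ofReal (s ^ (q - 1))
        ≤ (ENNReal.ofReal (4 / s ^ 2) * ∫⁻ x in E s, ‖f x‖ₑ ^ (2 : ℝ) ∂μ) *
          ENNReal.ofReal (s ^ (q - 1)) := by
          gcongr
          exact meas_lt_norm_le_of_weak_bounds hadd hmeas h1 h2 hf hfm hp hA hfA hs0
      _ = _ := by
          rw [mul_right_comm, ← ENNReal.ofReal_mul (by positivity)]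
          congr 2
          rw [show q - 3 = (q - 1) - (2 : ℝ) by ring, Real.rpow_sub hs0 (q - 1), Real.rpow_two]
          ring
  have hinner : ∀ x, ∫⁻ s in Set.Ioi 0, Φ s x ≤
      ENNReal.ofReal (4 * (2 * A) ^ (q - 2) / (q - 2)) * ‖f x‖ₑ ^ p := by
    intro x
    rcases (norm_nonneg (f x)).eq_or_lt with h | hfx
    · have hfx : f x = 0 := norm_eq_zero.1 h.symm
      have : ∀ s, Φ s x = 0 := fun s => by
        refine Set.indicator_apply_eq_zero.2 fun _ => ?_
        simp [hfx]
      simp [this]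
    · set B := 2 * A * (‖f x‖ ^ (p - 1))⁻¹ with hB
      have hB0 : 0 ≤ B := by positivity
      have hΦx : ∀ s ∈ Set.Ioi (0 : ℝ), Φ s x = (Set.Ioc 0 B).indicator
          (fun s => ENNReal.ofReal (4 * ‖f x‖ ^ (2 : ℝ)) * ENNReal.ofReal (s ^ (q - 3))) s := by
        intro s hs
        have hs0 : 0 < s := hs
        have hiff : (s, x) ∈ Q ↔ s ∈ Set.Ioc 0 B := by
          have h1 : s ≤ B ↔ s * ‖f x‖ ^ (p - 1) ≤ 2 * A := by
            rw [hB, ← div_eq_mul_inv, le_div_iff₀ (by positivity)]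
          simp [hQ, Set.mem_Ioc, hs0, h1]
        by_cases hsB : s ∈ Set.Ioc 0 B
        · simp only [hΦ]
          rw [Set.indicator_of_mem hsB, Set.indicator_of_mem (hiff.2 hsB), ← ofReal_norm,
            ENNReal.ofReal_rpow_of_pos hfx, ← ENNReal.ofReal_mul (by positivity),
            ← ENNReal.ofReal_mul (by positivity)]
          congr 1
          ring
        · simp only [hΦ]
          rw [Set.indicator_of_notMem hsB, Set.indicator_of_notMem (mt hiff.1 hsB)]
      rw [setLIntegral_congr_fun measurableSet_Ioi hΦx, lintegral_indicator measurableSet_Ioc,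
        Measure.restrict_restrict measurableSet_Ioc,
        Set.inter_eq_left.2 Set.Ioc_subset_Ioi_self,
        lintegral_const_mul' _ _ ENNReal.ofReal_ne_top, setLIntegral_rpow_Ioc hq hB0,
        ← ofReal_norm, ENNReal.ofReal_rpow_of_pos hfx, ← ENNReal.ofReal_mul (by positivity),
        ← ENNReal.ofReal_mul (by have : 0 < q - 2 := by linarith
                                 positivity)]
      refine (congrArg ENNReal.ofReal ?_).le
      have hexp : ‖f x‖ ^ (2 : ℝ) * ((‖f x‖ ^ (p - 1))⁻¹) ^ (q - 2) = ‖f x‖ ^ p := by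
        rw [← Real.rpow_neg hfx.le, ← Real.rpow_mul hfx.le, ← Real.rpow_add hfx]
        congr 1
        have := hpq.mul_eq_add
        linear_combination -this
      rw [hB, Real.mul_rpow (by positivity) (by positivity), ← hexp]
      ring
  rw [hlhs, hlc]
  calc ENNReal.ofReal q * ∫⁻ s in Set.Ioi 0, μ {x | s < ‖T f x‖} * ENNReal.ofReal (s ^ (q - 1))
      ≤ ENNReal.ofReal q * ∫⁻ s in Set.Ioi 0, ∫⁻ x, Φ s x ∂μ := by
        exact mul_le_mul_right (setLIntegral_mono' measurableSet_Ioi hbound) _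
    _ = ENNReal.ofReal q * ∫⁻ x, ∫⁻ s in Set.Ioi (0 : ℝ), Φ s x ∂volume ∂μ := by
        rw [lintegral_lintegral_swap hΦm.aemeasurable]
    _ ≤ ENNReal.ofReal q * ∫⁻ x, ENNReal.ofReal (4 * (2 * A) ^ (q - 2) / (q - 2)) *
          ‖f x‖ₑ ^ p ∂μ := by
        exact mul_le_mul_right (lintegral_mono hinner) _
    _ = _ := by
        have : 0 < q - 2 := by linarith
        rw [lintegral_const_mul' _ _ ENNReal.ofReal_ne_top, hfA,
          ← ENNReal.ofReal_mul (by positivity), ← ENNReal.ofReal_mul (by positivity)]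
        congr 1
        rw [Real.mul_rpow two_pos.le hA.le, show q - 1 = (q - 2) + 1 by ring, Real.rpow_add hA,
          Real.rpow_one]
        ring

theorem dunklTransform_congr {k : ℝ} {f g : ℝ → ℂ} (h : f =ᵐ[dunklMeasure k] g) :
    dunklTransform k f = dunklTransform k g :=
  funext fun lam => integral_congr_ae (h.mono fun x hx => by simp only [hx])

theorem dunklTransform_add {k : ℝ} (hk : -(1 / 2 : ℝ) ≤ k) {f g : ℝ → ℂ}
    (hf : Integrable f (dunklMeasure k)) (hg : Integrable g (dunklMeasure k)) (lam : ℝ) :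
    dunklTransform k (f + g) lam = dunklTransform k f lam + dunklTransform k g lam := by
  simp only [dunklTransform, Pi.add_apply, add_mul]
  exact integral_add (integrable_mul_dunklKernel hk hf lam) (integrable_mul_dunklKernel hk hg lam)

theorem lintegral_sq_dunklTransform_le {k : ℝ} (hk : -(1 / 2 : ℝ) ≤ k) {f : ℝ → ℂ}
    (hf : Integrable f (dunklMeasure k)) :
    ∫⁻ x, ‖dunklTransform k f x‖ₑ ^ (2 : ℝ) ∂dunklMeasure k ≤
      ∫⁻ x, ‖f x‖ₑ ^ (2 : ℝ) ∂dunklMeasure k := by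
  have h2 : (2 : ENNReal) = ENNReal.ofReal 2 := by simp
  rcases eq_or_ne (∫⁻ x, ‖f x‖ₑ ^ (2 : ℝ) ∂dunklMeasure k) ⊤ with h | h
  · rw [h]
    exact le_top
  · have hf2 : MemLp f 2 (dunklMeasure k) := by
      refine ⟨hf.1, ?_⟩
      rw [h2, eLpNorm_ofReal_eq two_pos]
      exact ENNReal.rpow_lt_top_of_nonneg (by norm_num) h
    have := eLpNorm_two_dunklTransform_le hk hf hf2
    rw [h2, eLpNorm_ofReal_eq two_pos, eLpNorm_ofReal_eq two_pos] at this
    exact (ENNReal.rpow_le_rpow_iff (by norm_num)).1 this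

/-- The Hausdorff–Young inequality for the Dunkl transform. -/
theorem exists_eLpNorm_dunklTransform_le {k p q : ℝ} (hk : -(1 / 2 : ℝ) ≤ k) (hp1 : 1 < p)
    (hp2 : p ≤ 2) (hpq : p.HolderConjugate q) :
    ∃ C : ℝ, 0 < C ∧ ∀ f, Integrable f (dunklMeasure k) →
      eLpNorm (dunklTransform k f) (ENNReal.ofReal q) (dunklMeasure k) ≤
        ENNReal.ofReal C * eLpNorm f (ENNReal.ofReal p) (dunklMeasure k) := by
  have := isLocallyFiniteMeasure_dunklMeasure hk
  have hp0 : 0 < p := by linarith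
  have hq0 : 0 < q := hpq.symm.pos
  rcases hp2.eq_or_lt with rfl | hp2
  · have hq2 : q = 2 := by
      have := hpq.mul_eq_add
      linarith
    subst hq2
    refine ⟨1, one_pos, fun f hf => ?_⟩
    rw [ENNReal.ofReal_one, one_mul, eLpNorm_ofReal_eq two_pos, eLpNorm_ofReal_eq two_pos]
    exact ENNReal.rpow_le_rpow (lintegral_sq_dunklTransform_le hk hf) (by norm_num)
  · have hq2 : 2 < q := by
      have := hpq.mul_eq_add
      nlinarith
    set c := q * 4 * 2 ^ (q - 2) / (q - 2) with hc
    have hcpos : 0 < c := by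
      have : 0 < q - 2 := by linarith
      positivity
    refine ⟨c ^ (1 / q), by positivity, fun f hf => ?_⟩
    -- The transform and the norms see only the class of `f` modulo null sets.
    wlog hfm : StronglyMeasurable f generalizing f
    · have hae := hf.1.ae_eq_mk
      have := this (hf.1.mk f) (hf.congr hae) hf.1.stronglyMeasurable_mk
      rwa [← dunklTransform_congr hae, ← eLpNorm_congr_ae hae] at this
    rw [eLpNorm_ofReal_eq hp0, eLpNorm_ofReal_eq hq0]
    rcases eq_or_ne (∫⁻ x, ‖f x‖ₑ ^ p ∂dunklMeasure k) ⊤ with htop | htop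
    · rw [htop, ENNReal.top_rpow_of_pos (by positivity), ENNReal.mul_top]
      · exact le_top
      · simpa using Real.rpow_pos_of_pos hcpos _
    rcases eq_or_ne (∫⁻ x, ‖f x‖ₑ ^ p ∂dunklMeasure k) 0 with hzero | hzero
    · have hf0 : f =ᵐ[dunklMeasure k] 0 := by
        rw [lintegral_eq_zero_iff (hfm.enorm.pow_const p)] at hzero
        filter_upwards [hzero] with x hx
        simpa [hp0, hp0.not_gt] using hx
      have hT : dunklTransform k f = 0 := by
        rw [dunklTransform_congr hf0]
        ext lam
        simp [dunklTransform]
      simp [hT, hq0]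
    · set A := (∫⁻ x, ‖f x‖ₑ ^ p ∂dunklMeasure k).toReal with hA
      have hA0 : 0 < A := ENNReal.toReal_pos hzero htop
      have hfA : ∫⁻ x, ‖f x‖ₑ ^ p ∂dunklMeasure k = ENNReal.ofReal A :=
        (ENNReal.ofReal_toReal htop).symm
      have key := lintegral_rpow_le_of_weak_bounds (T := dunklTransform k)
        (fun f g hf hg x => dunklTransform_add hk hf hg x)
        (fun f hf => (continuous_dunklTransform hk hf).aestronglyMeasurable)
        (fun f _ x => enorm_dunklTransform_le hk f x)
        (fun f hf => lintegral_sq_dunklTransform_le hk hf) hf hfm hp1 hpq hq2 hA0 hfA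
      rw [hfA, ENNReal.ofReal_rpow_of_pos hA0, ← ENNReal.ofReal_mul (by positivity)]
      refine (ENNReal.rpow_le_rpow key (by positivity)).trans_eq ?_
      rw [ENNReal.ofReal_rpow_of_nonneg (by positivity) (by positivity),
        Real.mul_rpow (by positivity) (by positivity), ← Real.rpow_mul hA0.le]
      congr 3
      have := hpq.mul_eq_add
      field_simp
      linarith

/-! ### Bounds for the linear canonical Dunkl transform -/

/-- The chirp `exp (i c x ^ 2 / 2)`. -/
def chirp (c x : ℝ) : ℂ := Complex.exp (Complex.I / 2 * ((c * x ^ 2 : ℝ) : ℂ))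

theorem norm_chirp (c x : ℝ) : ‖chirp c x‖ = 1 := by
  rw [chirp, show Complex.I / 2 * ((c * x ^ 2 : ℝ) : ℂ) = ((c * x ^ 2 / 2 : ℝ) : ℂ) * Complex.I by
    push_cast; ring, Complex.norm_exp_ofReal_mul_I]

theorem continuous_chirp (c : ℝ) : Continuous (chirp c) := by
  unfold chirp
  fun_prop

theorem integrable_mul_chirp {k c : ℝ} {f : ℝ → ℂ} (hf : Integrable f (dunklMeasure k)) :
    Integrable (fun x => f x * chirp c x) (dunklMeasure k) :=
  hf.mul_bdd (c := 1) (continuous_chirp c).aestronglyMeasurable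
    (ae_of_all _ fun x => (norm_chirp c x).le)

variable {k : ℝ} {M : Matrix.SpecialLinearGroup (Fin 2) ℝ}

theorem lcdt_eq (hb : M 0 1 ≠ 0) (f : ℝ → ℂ) (lam : ℝ) :
    lcdt k M f lam = 1 / (Complex.I * (M 0 1 : ℂ)) ^ ((k + 1 : ℝ) : ℂ) *
      (chirp (M 1 1 / M 0 1) lam *
        dunklTransform k (fun x => f x * chirp (M 0 0 / M 0 1) x) ((M 0 1)⁻¹ * lam)) := by
  rw [lcdt, if_neg hb, dunklTransform]
  congr 1
  rw [← integral_const_mul]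
  refine integral_congr_ae (ae_of_all _ fun x => ?_)
  simp only [lcdtKernel, chirp]
  rw [Complex.ofReal_add, mul_add, Complex.exp_add, div_eq_inv_mul lam]
  ring

theorem norm_lcdt (hb : M 0 1 ≠ 0) (f : ℝ → ℂ) (lam : ℝ) :
    ‖lcdt k M f lam‖ = |M 0 1| ^ (-(k + 1)) *
      ‖dunklTransform k (fun x => f x * chirp (M 0 0 / M 0 1) x) ((M 0 1)⁻¹ * lam)‖ := by
  rw [lcdt_eq hb, norm_mul, norm_mul, norm_chirp, one_mul, norm_div, norm_one,
    Complex.norm_cpow_real, norm_mul, Complex.norm_I, one_mul, Complex.norm_real,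
    Real.norm_eq_abs, Real.rpow_neg (abs_nonneg _), one_div]

theorem continuous_lcdt (hk : -(1 / 2 : ℝ) ≤ k) (hb : M 0 1 ≠ 0) {f : ℝ → ℂ}
    (hf : Integrable f (dunklMeasure k)) : Continuous (lcdt k M f) := by
  have h : lcdt k M f = fun lam => _ := funext fun lam => lcdt_eq hb f lam
  rw [h]
  have h1 := continuous_dunklTransform hk
    (integrable_mul_chirp (c := M 0 0 / M 0 1) hf)
  have h2 := continuous_chirp (M 1 1 / M 0 1)
  fun_prop

theorem lcdt_sub (hk : -(1 / 2 : ℝ) ≤ k) (hb : M 0 1 ≠ 0) {f g : ℝ → ℂ}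
    (hf : Integrable f (dunklMeasure k)) (hg : Integrable g (dunklMeasure k)) (lam : ℝ) :
    lcdt k M (f - g) lam = lcdt k M f lam - lcdt k M g lam := by
  rw [lcdt_eq hb, lcdt_eq hb, lcdt_eq hb, ← mul_sub, ← mul_sub]
  congr 2
  simp only [dunklTransform, Pi.sub_apply, sub_mul]
  exact integral_sub (integrable_mul_dunklKernel hk (integrable_mul_chirp hf) _)
    (integrable_mul_dunklKernel hk (integrable_mul_chirp hg) _)

theorem enorm_lcdt_le (hk : -(1 / 2 : ℝ) ≤ k) (hb : M 0 1 ≠ 0) (f : ℝ → ℂ) (lam : ℝ) :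
    ‖lcdt k M f lam‖ₑ ≤
      ENNReal.ofReal (|M 0 1| ^ (-(k + 1))) * ∫⁻ x, ‖f x‖ₑ ∂dunklMeasure k := by
  rw [← ofReal_norm, norm_lcdt hb, ENNReal.ofReal_mul (by positivity), ofReal_norm]
  refine mul_le_mul_right ((enorm_dunklTransform_le hk _ _).trans_eq ?_) _
  refine lintegral_congr fun x => ?_
  rw [enorm_mul, ← ofReal_norm (chirp _ _), norm_chirp, ENNReal.ofReal_one, mul_one]

/-- The Hausdorff–Young inequality for the linear canonical Dunkl transform, with a constant that
depends on the matrix through its upper right entry only. -/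
theorem exists_eLpNorm_lcdt_le {p q b : ℝ} (hk : -(1 / 2 : ℝ) ≤ k) (hp1 : 1 < p)
    (hp2 : p ≤ 2) (hpq : p.HolderConjugate q) (hb : b ≠ 0) :
    ∃ C : ℝ, 0 < C ∧ ∀ M : Matrix.SpecialLinearGroup (Fin 2) ℝ, M 0 1 = b →
      ∀ f, Integrable f (dunklMeasure k) →
      eLpNorm (lcdt k M f) (ENNReal.ofReal q) (dunklMeasure k) ≤
        ENNReal.ofReal C * eLpNorm f (ENNReal.ofReal p) (dunklMeasure k) := by
  obtain ⟨C, hC, hY⟩ := exists_eLpNorm_dunklTransform_le hk hp1 hp2 hpq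
  have hb' : 0 < |b| := abs_pos.2 hb
  have hq0 : 0 < q := hpq.symm.pos
  refine ⟨|b| ^ (-(k + 1)) * (|b⁻¹| ^ (-(2 * k + 2))) ^ (1 / q) * C, by positivity,
    fun M hM f hf => ?_⟩
  subst hM
  set fc : ℝ → ℂ := fun x => f x * chirp (M 0 0 / M 0 1) x with hfc
  have hm : MeasurableEmbedding fun x : ℝ => (M 0 1)⁻¹ * x :=
    measurableEmbedding_mulLeft₀ (inv_ne_zero hb)
  have h1 : eLpNorm (lcdt k M f) (ENNReal.ofReal q) (dunklMeasure k) =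
      ENNReal.ofReal (|M 0 1| ^ (-(k + 1))) *
        eLpNorm (dunklTransform k fc ∘ fun x => (M 0 1)⁻¹ * x) (ENNReal.ofReal q)
          (dunklMeasure k) := by
    have hc : ENNReal.ofReal (|M 0 1| ^ (-(k + 1))) = ‖|M 0 1| ^ (-(k + 1))‖ₑ :=
      (Real.enorm_of_nonneg (by positivity)).symm
    rw [hc, ← eLpNorm_const_smul]
    refine eLpNorm_congr_norm_ae (ae_of_all _ fun x => ?_)
    rw [norm_lcdt hb, Pi.smul_apply, norm_smul, Real.norm_of_nonneg (by positivity)]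
    rfl
  have h2 : eLpNorm fc (ENNReal.ofReal p) (dunklMeasure k) =
      eLpNorm f (ENNReal.ofReal p) (dunklMeasure k) :=
    eLpNorm_congr_norm_ae (ae_of_all _ fun x => by rw [hfc, norm_mul, norm_chirp, mul_one])
  rw [h1, ← hm.eLpNorm_map_measure, map_mul_dunklMeasure hk (inv_ne_zero hb),
    eLpNorm_smul_measure_of_ne_top ENNReal.ofReal_ne_top, smul_eq_mul,
    ENNReal.toReal_div, ENNReal.toReal_one, ENNReal.toReal_ofReal hq0.le,
    ENNReal.ofReal_rpow_of_nonneg (by positivity) (by positivity), ← mul_assoc,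
    ENNReal.ofReal_mul (by positivity), ENNReal.ofReal_mul (by positivity),
    mul_assoc _ _ (eLpNorm f _ _), ← h2]
  exact mul_le_mul_right (hY fc (integrable_mul_chirp hf)) _

/-! ### Extension by continuity -/

theorem memLp_one_indicator_of_memLp {p : ℝ} (hk : -(1 / 2 : ℝ) ≤ k) (hp : 1 ≤ p) {f : ℝ → ℂ}
    (hf : MemLp f (ENNReal.ofReal p) (dunklMeasure k)) (r : ℝ) :
    MemLp ({x : ℝ | |x| ≤ r}.indicator f) 1 (dunklMeasure k) := by
  have := isLocallyFiniteMeasure_dunklMeasure hk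
  rw [memLp_indicator_iff_restrict (measurableSet_abs_le r)]
  have hfin : IsFiniteMeasure ((dunklMeasure k).restrict {x : ℝ | |x| ≤ r}) := by
    have hset : {x : ℝ | |x| ≤ r} = Metric.closedBall 0 r := by
      ext x
      simp
    rw [hset]
    exact ⟨by simpa using (isCompact_closedBall (0 : ℝ) r).measure_lt_top⟩
  exact (hf.restrict _).mono_exponent (ENNReal.one_le_ofReal.2 hp)

theorem tendsto_eLpNorm_indicator_sub {p : ℝ} (hp : 0 < p) {f : ℝ → ℂ}
    (hf : MemLp f (ENNReal.ofReal p) (dunklMeasure k)) :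
    Tendsto (fun n : ℕ => eLpNorm (fun x => {x : ℝ | |x| ≤ n}.indicator f x - f x)
      (ENNReal.ofReal p) (dunklMeasure k)) atTop (𝓝 0) := by
  have hfin : ∫⁻ x, ‖f x‖ₑ ^ p ∂dunklMeasure k ≠ ⊤ := by
    have := lintegral_rpow_enorm_lt_top_of_eLpNorm_lt_top (by simpa using hp)
      ENNReal.ofReal_ne_top hf.2
    rw [ENNReal.toReal_ofReal hp.le] at this
    exact this.ne
  have hlim : Tendsto (fun n : ℕ => ∫⁻ x, ‖{x : ℝ | |x| ≤ n}.indicator f x - f x‖ₑ ^ p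
      ∂dunklMeasure k) atTop (𝓝 (∫⁻ _, 0 ∂dunklMeasure k)) := by
    refine tendsto_lintegral_of_dominated_convergence' (fun x => ‖f x‖ₑ ^ p)
      (fun n => ((hf.1.indicator (measurableSet_abs_le n)).sub hf.1).enorm.pow_const p)
      (fun n => ae_of_all _ fun x => ?_) hfin (ae_of_all _ fun x => ?_)
    · refine ENNReal.rpow_le_rpow ?_ hp.le
      by_cases hx : |x| ≤ n
      · simp [Set.indicator, hx]
      · simp [Set.indicator, hx]
    · obtain ⟨N, hN⟩ := exists_nat_ge |x|
      refine tendsto_const_nhds.congr' ?_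
      filter_upwards [eventually_ge_atTop N] with n hn
      have hx : |x| ≤ n := hN.trans (by exact_mod_cast hn)
      simp [Set.indicator, hx, hp]
  rw [lintegral_zero] at hlim
  have := (ENNReal.continuous_rpow_const (y := 1 / p)).tendsto 0 |>.comp hlim
  rw [ENNReal.zero_rpow_of_pos (by positivity)] at this
  refine this.congr fun n => ?_
  rw [eLpNorm_ofReal_eq hp]
  rfl

/-- The Hausdorff–Young bound survives the passage to the limit, also for the difference of `f` from
an element `u` of `L¹ ∩ L^p`. -/
theorem IsLCDT.eLpNorm_sub_le {p q C : ℝ} (hk : -(1 / 2 : ℝ) ≤ k) (hb : M 0 1 ≠ 0) (hp : 1 ≤ p)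
    (hq : 1 ≤ q)
    (hY : ∀ f, Integrable f (dunklMeasure k) →
      eLpNorm (lcdt k M f) (ENNReal.ofReal q) (dunklMeasure k) ≤
        ENNReal.ofReal C * eLpNorm f (ENNReal.ofReal p) (dunklMeasure k))
    {f g u : ℝ → ℂ} (h : IsLCDT k M p q f g) (hu1 : MemLp u 1 (dunklMeasure k))
    (hup : MemLp u (ENNReal.ofReal p) (dunklMeasure k)) :
    eLpNorm (g - lcdt k M u) (ENNReal.ofReal q) (dunklMeasure k) ≤
      ENNReal.ofReal C * eLpNorm (f - u) (ENNReal.ofReal p) (dunklMeasure k) := by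
  obtain ⟨hf, hg, F, hF, hFf, hFg⟩ := h
  have hu := memLp_one_iff_integrable.1 hu1
  have hFi : ∀ n, Integrable (F n) (dunklMeasure k) := fun n =>
    memLp_one_iff_integrable.1 (hF n).1
  have hmT : ∀ n, AEStronglyMeasurable (lcdt k M (F n)) (dunklMeasure k) := fun n =>
    (continuous_lcdt hk hb (hFi n)).aestronglyMeasurable
  have hle : ∀ n, eLpNorm (g - lcdt k M u) (ENNReal.ofReal q) (dunklMeasure k) ≤
      eLpNorm (fun x => lcdt k M (F n) x - g x) (ENNReal.ofReal q) (dunklMeasure k) +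
      ENNReal.ofReal C * (eLpNorm (fun x => F n x - f x) (ENNReal.ofReal p) (dunklMeasure k) +
        eLpNorm (f - u) (ENNReal.ofReal p) (dunklMeasure k)) := fun n => by
    have e1 : g - lcdt k M u = (g - lcdt k M (F n)) + lcdt k M (F n - u) := by
      ext x
      simp only [Pi.sub_apply, Pi.add_apply, lcdt_sub hk hb (hFi n) hu]
      ring
    have e2 : F n - u = (F n - f) + (f - u) := by abel
    rw [e1]
    refine (eLpNorm_add_le (hg.1.sub (hmT n))
      (continuous_lcdt hk hb ((hFi n).sub hu)).aestronglyMeasurable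
      (ENNReal.one_le_ofReal.2 hq)).trans ?_
    rw [eLpNorm_sub_comm]
    refine add_le_add le_rfl ((hY _ ((hFi n).sub hu)).trans (mul_le_mul_right ?_ _))
    rw [e2]
    exact eLpNorm_add_le ((hF n).2.1.sub hf.1) (hf.1.sub hup.1) (ENNReal.one_le_ofReal.2 hp)
  have hlim : Tendsto (fun n => eLpNorm (fun x => lcdt k M (F n) x - g x) (ENNReal.ofReal q)
      (dunklMeasure k) + ENNReal.ofReal C * (eLpNorm (fun x => F n x - f x) (ENNReal.ofReal p)
      (dunklMeasure k) + eLpNorm (f - u) (ENNReal.ofReal p) (dunklMeasure k))) atTop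
      (𝓝 (0 + ENNReal.ofReal C * (0 + eLpNorm (f - u) (ENNReal.ofReal p) (dunklMeasure k)))) :=
    hFg.add (ENNReal.Tendsto.const_mul (hFf.add tendsto_const_nhds)
      (Or.inr ENNReal.ofReal_ne_top))
  rw [zero_add, zero_add] at hlim
  exact ge_of_tendsto' hlim hle

theorem IsLCDT.ae_eq {p q C : ℝ} (hk : -(1 / 2 : ℝ) ≤ k) (hb : M 0 1 ≠ 0) (hp : 1 ≤ p)
    (hq : 1 ≤ q)
    (hY : ∀ f, Integrable f (dunklMeasure k) →
      eLpNorm (lcdt k M f) (ENNReal.ofReal q) (dunklMeasure k) ≤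
        ENNReal.ofReal C * eLpNorm f (ENNReal.ofReal p) (dunklMeasure k))
    {f g h : ℝ → ℂ} (hg : IsLCDT k M p q f g) (hh : IsLCDT k M p q f h) :
    h =ᵐ[dunklMeasure k] g := by
  obtain ⟨hf, hhq, F, hF, hFf, hFh⟩ := hh
  have hmT : ∀ n, AEStronglyMeasurable (lcdt k M (F n)) (dunklMeasure k) := fun n =>
    (continuous_lcdt hk hb (memLp_one_iff_integrable.1 (hF n).1)).aestronglyMeasurable
  have hle : ∀ n, eLpNorm (g - h) (ENNReal.ofReal q) (dunklMeasure k) ≤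
      ENNReal.ofReal C * eLpNorm (fun x => F n x - f x) (ENNReal.ofReal p) (dunklMeasure k) +
      eLpNorm (fun x => lcdt k M (F n) x - h x) (ENNReal.ofReal q) (dunklMeasure k) := fun n => by
    have e1 : g - h = (g - lcdt k M (F n)) + (lcdt k M (F n) - h) := by abel
    rw [e1]
    refine (eLpNorm_add_le (hg.2.1.1.sub (hmT n)) ((hmT n).sub hhq.1)
      (ENNReal.one_le_ofReal.2 hq)).trans (add_le_add ?_ le_rfl)
    refine (hg.eLpNorm_sub_le hk hb hp hq hY (hF n).1 (hF n).2).trans_eq ?_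
    rw [eLpNorm_sub_comm]
    rfl
  have hlim := (ENNReal.Tendsto.const_mul (a := ENNReal.ofReal C) hFf
    (Or.inr ENNReal.ofReal_ne_top)).add hFh
  rw [mul_zero, zero_add] at hlim
  have h0 : eLpNorm (g - h) (ENNReal.ofReal q) (dunklMeasure k) = 0 :=
    le_antisymm (ge_of_tendsto' hlim hle) bot_le
  rw [eLpNorm_eq_zero_iff (hg.2.1.1.sub hhq.1) (by simpa using by linarith)] at h0
  filter_upwards [h0] with x hx
  exact (sub_eq_zero.1 hx).symm

theorem exists_isLCDT {p q C : ℝ} (hk : -(1 / 2 : ℝ) ≤ k) (hb : M 0 1 ≠ 0) (hp : 1 ≤ p)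
    (hq : 1 ≤ q) (hC : 0 < C)
    (hY : ∀ f, Integrable f (dunklMeasure k) →
      eLpNorm (lcdt k M f) (ENNReal.ofReal q) (dunklMeasure k) ≤
        ENNReal.ofReal C * eLpNorm f (ENNReal.ofReal p) (dunklMeasure k))
    {f : ℝ → ℂ} (hf : MemLp f (ENNReal.ofReal p) (dunklMeasure k)) :
    ∃ g, IsLCDT k M p q f g := by
  have : Fact (1 ≤ ENNReal.ofReal p) := ⟨ENNReal.one_le_ofReal.2 hp⟩
  have : Fact (1 ≤ ENNReal.ofReal q) := ⟨ENNReal.one_le_ofReal.2 hq⟩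
  set F : ℕ → ℝ → ℂ := fun n => {x : ℝ | |x| ≤ n}.indicator f with hF
  have hF1 : ∀ n, MemLp (F n) 1 (dunklMeasure k) := fun n =>
    memLp_one_indicator_of_memLp hk hp hf n
  have hFi : ∀ n, Integrable (F n) (dunklMeasure k) := fun n => memLp_one_iff_integrable.1 (hF1 n)
  have hFp : ∀ n, MemLp (F n) (ENNReal.ofReal p) (dunklMeasure k) := fun n =>
    hf.indicator (measurableSet_abs_le n)
  have hFf := tendsto_eLpNorm_indicator_sub (by linarith) hf
  have hT : ∀ n, MemLp (lcdt k M (F n)) (ENNReal.ofReal q) (dunklMeasure k) := fun n =>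
    ⟨(continuous_lcdt hk hb (hFi n)).aestronglyMeasurable,
      (hY _ (hFi n)).trans_lt (ENNReal.mul_lt_top ENNReal.ofReal_lt_top (hFp n).2)⟩
  have hlimF : Tendsto (fun n => (hFp n).toLp) atTop (𝓝 hf.toLp) :=
    (Lp.tendsto_Lp_iff_tendsto_eLpNorm'' F hFp f hf).2 hFf
  have hcau : CauchySeq fun n => (hT n).toLp := by
    rw [EMetric.cauchySeq_iff]
    intro ε hε
    have hK0 : ENNReal.ofReal C ≠ 0 := by simpa using hC
    obtain ⟨N, hN⟩ := EMetric.cauchySeq_iff.1 hlimF.cauchySeq (ε / ENNReal.ofReal C)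
      (ENNReal.div_pos hε.ne' ENNReal.ofReal_ne_top)
    refine ⟨N, fun m hm n hn => ?_⟩
    have h1 := hN m hm n hn
    rw [Lp.edist_toLp_toLp, ENNReal.lt_div_iff_mul_lt (Or.inl hK0) (Or.inl ENNReal.ofReal_ne_top),
      mul_comm] at h1
    rw [Lp.edist_toLp_toLp]
    refine lt_of_le_of_lt ?_ h1
    have e : lcdt k M (F m) - lcdt k M (F n) = lcdt k M (F m - F n) := by
      ext x
      rw [lcdt_sub hk hb (hFi m) (hFi n)]
      rfl
    rw [e]
    exact hY _ ((hFi m).sub (hFi n))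
  obtain ⟨G, hG⟩ := cauchySeq_tendsto_of_complete hcau
  refine ⟨G, hf, Lp.memLp G, F, fun n => ⟨hF1 n, hFp n⟩, hFf, ?_⟩
  have := (Lp.tendsto_Lp_iff_tendsto_eLpNorm'' _ hT G (Lp.memLp G)).1 (by rwa [Lp.toLp_coeFn])
  exact this

/-! ### The uncertainty inequality -/

/-- Near the origin, Hölder's inequality bounds the `L¹` norm by the weighted `L^p` norm; the
condition `α q < 2 k + 2` makes the dual weight integrable. -/
theorem exists_setLIntegral_enorm_le {p q α : ℝ} (hk : -(1 / 2 : ℝ) ≤ k)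
    (hpq : p.HolderConjugate q) (hα : α * q < 2 * k + 2) :
    ∃ D : ℝ, 0 < D ∧ ∀ f : ℝ → ℂ, AEStronglyMeasurable f (dunklMeasure k) → ∀ s : ℝ, 0 < s →
      ∫⁻ x in {x | |x| ≤ s}, ‖f x‖ₑ ∂dunklMeasure k ≤
        ENNReal.ofReal (D * s ^ ((2 * k + 2) / q - α)) *
          eLpNorm (fun y => ((|y| ^ α : ℝ) : ℂ) * f y) (ENNReal.ofReal p) (dunklMeasure k) := by
  have hq : 0 < q := hpq.symm.pos
  have hp : 0 < p := hpq.pos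
  obtain ⟨D, hD, hD'⟩ := exists_setLIntegral_abs_rpow_le hk hα
  refine ⟨D ^ (1 / q), by positivity, fun f hf s hs => ?_⟩
  have hne : ∀ᵐ x ∂(dunklMeasure k).restrict {x | |x| ≤ s}, x ≠ 0 := by
    refine ae_restrict_of_ae ?_
    rw [ae_iff]
    simpa using dunklMeasure_singleton k 0
  have hfac : ∫⁻ x in {x | |x| ≤ s}, ‖f x‖ₑ ∂dunklMeasure k =
      ∫⁻ x in {x | |x| ≤ s}, ((fun x => ‖((|x| ^ α : ℝ) : ℂ) * f x‖ₑ) *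
        fun x => ENNReal.ofReal (|x| ^ (-α))) x ∂dunklMeasure k := by
    refine lintegral_congr_ae (hne.mono fun x hx => ?_)
    have hx0 : 0 < |x| := abs_pos.2 hx
    simp only [Pi.mul_apply]
    rw [enorm_mul, ← ofReal_norm ((|x| ^ α : ℝ) : ℂ), Complex.norm_real,
      Real.norm_of_nonneg (by positivity), mul_right_comm, ← ENNReal.ofReal_mul (by positivity),
      ← Real.rpow_add hx0]
    simp
  have hwm : Measurable fun x : ℝ => |x| ^ α := measurable_norm.pow_const α
  have hfm : AEMeasurable (fun x => ‖((|x| ^ α : ℝ) : ℂ) * f x‖ₑ)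
      ((dunklMeasure k).restrict {x | |x| ≤ s}) :=
    (((Complex.measurable_ofReal.comp hwm).aestronglyMeasurable.mul hf).enorm).restrict
  have hgm : AEMeasurable (fun x : ℝ => ENNReal.ofReal (|x| ^ (-α)))
      ((dunklMeasure k).restrict {x | |x| ≤ s}) :=
    (measurable_norm.pow_const (-α)).ennreal_ofReal.aemeasurable
  rw [hfac]
  refine (ENNReal.lintegral_mul_le_Lp_mul_Lq _ hpq hfm hgm).trans ?_
  rw [mul_comm, eLpNorm_ofReal_eq hp]
  refine mul_le_mul' ?_ (ENNReal.rpow_le_rpow (setLIntegral_le_lintegral _ _) (by positivity))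
  have hpow : ∀ x : ℝ, ENNReal.ofReal (|x| ^ (-α)) ^ q = ENNReal.ofReal (|x| ^ (-(α * q))) :=
    fun x => by
      rw [ENNReal.ofReal_rpow_of_nonneg (by positivity) hq.le, ← Real.rpow_mul (abs_nonneg _),
        neg_mul]
  simp only [hpow]
  refine (ENNReal.rpow_le_rpow (hD' s hs) (by positivity)).trans_eq ?_
  rw [ENNReal.ofReal_rpow_of_nonneg (by positivity) (by positivity),
    Real.mul_rpow hD.le (by positivity), ← Real.rpow_mul hs.le]
  congr 3
  field_simp

theorem eLpNorm_sub_indicator_le {p γ r : ℝ} (hγ : 0 < γ) (hr : 0 < r) (f : ℝ → ℂ) :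
    eLpNorm (f - {x : ℝ | |x| ≤ r}.indicator f) (ENNReal.ofReal p) (dunklMeasure k) ≤
      ENNReal.ofReal (r ^ (-γ)) *
        eLpNorm (fun y => ((|y| ^ γ : ℝ) : ℂ) * f y) (ENNReal.ofReal p) (dunklMeasure k) := by
  have hc : ENNReal.ofReal (r ^ (-γ)) = ‖r ^ (-γ)‖ₑ :=
    (Real.enorm_of_nonneg (by positivity)).symm
  rw [hc, ← eLpNorm_const_smul]
  refine eLpNorm_mono fun x => ?_
  rw [Pi.smul_apply, norm_smul, norm_mul, Complex.norm_real,
    Real.norm_of_nonneg (by positivity : 0 ≤ r ^ (-γ)),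
    Real.norm_of_nonneg (by positivity : 0 ≤ |x| ^ γ), Pi.sub_apply]
  by_cases hx : |x| ≤ r
  · have : f x - {x : ℝ | |x| ≤ r}.indicator f x = 0 := by simp [Set.indicator, hx]
    rw [this, norm_zero]
    positivity
  · have : f x - {x : ℝ | |x| ≤ r}.indicator f x = f x := by simp [Set.indicator, hx]
    rw [this, ← mul_assoc]
    refine le_mul_of_one_le_left (norm_nonneg _) ?_
    rw [Real.rpow_neg hr.le, ← div_eq_inv_mul, one_le_div (by positivity)]
    exact Real.rpow_le_rpow hr.le (not_le.1 hx).le hγ.le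

theorem eLpNorm_indicator_lcdt_le {q : ℝ} (hk : -(1 / 2 : ℝ) ≤ k) (hb : M 0 1 ≠ 0) (hq : 0 < q)
    (u : ℝ → ℂ) (r : ℝ) :
    eLpNorm ({x : ℝ | |x| ≤ r}.indicator (lcdt k M u)) (ENNReal.ofReal q) (dunklMeasure k) ≤
      ENNReal.ofReal (|M 0 1| ^ (-(k + 1))) * (∫⁻ x, ‖u x‖ₑ ∂dunklMeasure k) *
        dunklMeasure k {x : ℝ | |x| ≤ r} ^ (1 / q) := by
  rw [eLpNorm_ofReal_eq hq]
  have h1 : ∫⁻ x, ‖{x : ℝ | |x| ≤ r}.indicator (lcdt k M u) x‖ₑ ^ q ∂dunklMeasure k ≤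
      (ENNReal.ofReal (|M 0 1| ^ (-(k + 1))) * (∫⁻ x, ‖u x‖ₑ ∂dunklMeasure k)) ^ q *
        dunklMeasure k {x : ℝ | |x| ≤ r} := by
    rw [← setLIntegral_const, ← lintegral_indicator (measurableSet_abs_le r)]
    refine lintegral_mono fun x => ?_
    by_cases hx : x ∈ {x : ℝ | |x| ≤ r}
    · simp only [Set.indicator_of_mem hx]
      exact ENNReal.rpow_le_rpow (enorm_lcdt_le hk hb u x) hq.le
    · simp [Set.indicator_of_notMem hx, hq]
  refine (ENNReal.rpow_le_rpow h1 (by positivity)).trans_eq ?_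
  rw [ENNReal.mul_rpow_of_nonneg _ _ (by positivity), ← ENNReal.rpow_mul,
    mul_one_div_cancel hq.ne', ENNReal.rpow_one]

/-- Optimizing `r` in `N ≤ K r^α X + r^{-β} Y`. -/
theorem le_mul_rpow_of_forall_le {N X Y : ENNReal} {α β K : ℝ} (hα : 0 < α) (hβ : 0 < β)
    (hK : 0 < K) (hX : X = 0 → N = 0) (hY : Y = 0 → N = 0)
    (h : ∀ r : ℝ, 0 < r →
      N ≤ ENNReal.ofReal (K * r ^ α) * X + ENNReal.ofReal (r ^ (-β)) * Y) :
    N ≤ ENNReal.ofReal (K + 1) * X ^ (β / (α + β)) * Y ^ (α / (α + β)) := by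
  have hβ' : 0 < β / (α + β) := by positivity
  have hα' : 0 < α / (α + β) := by positivity
  have hC : ENNReal.ofReal (K + 1) ≠ 0 := by simpa using by linarith
  rcases eq_or_ne X 0 with hX0 | hX0
  · rw [hX hX0]
    exact bot_le
  rcases eq_or_ne Y 0 with hY0 | hY0
  · rw [hY hY0]
    exact bot_le
  have hX0' : X ^ (β / (α + β)) ≠ 0 := fun h0 =>
    hX0 ((ENNReal.rpow_eq_zero_iff_of_pos hβ').1 h0)
  have hY0' : Y ^ (α / (α + β)) ≠ 0 := fun h0 =>
    hY0 ((ENNReal.rpow_eq_zero_iff_of_pos hα').1 h0)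
  rcases eq_or_ne X ⊤ with rfl | hXt
  · rw [ENNReal.top_rpow_of_pos hβ', ENNReal.mul_top hC, ENNReal.top_mul hY0']
    exact le_top
  rcases eq_or_ne Y ⊤ with rfl | hYt
  · rw [ENNReal.top_rpow_of_pos hα', ENNReal.mul_top (mul_ne_zero hC hX0')]
    exact le_top
  obtain ⟨x, hx, rfl⟩ : ∃ x : ℝ, 0 < x ∧ X = ENNReal.ofReal x :=
    ⟨X.toReal, ENNReal.toReal_pos hX0 hXt, (ENNReal.ofReal_toReal hXt).symm⟩
  obtain ⟨y, hy, rfl⟩ : ∃ y : ℝ, 0 < y ∧ Y = ENNReal.ofReal y :=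
    ⟨Y.toReal, ENNReal.toReal_pos hY0 hYt, (ENNReal.ofReal_toReal hYt).symm⟩
  -- The two terms balance, up to `K`, for `r ^ (α + β) = y / x`.
  refine (h ((y / x) ^ (1 / (α + β))) (by positivity)).trans_eq ?_
  rw [ENNReal.ofReal_rpow_of_pos hx, ENNReal.ofReal_rpow_of_pos hy,
    ← ENNReal.ofReal_mul (by positivity), ← ENNReal.ofReal_mul (by positivity),
    ← ENNReal.ofReal_mul (by positivity), ← ENNReal.ofReal_mul (by positivity),
    ← ENNReal.ofReal_add (by positivity) (by positivity)]
  congr 1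
  have hαβ : α + β ≠ 0 := by positivity
  have e1 : ((y / x) ^ (1 / (α + β))) ^ α * x = x ^ (β / (α + β)) * y ^ (α / (α + β)) := by
    have hxe : x ^ (β / (α + β)) = x / x ^ (α / (α + β)) := by
      rw [show β / (α + β) = 1 - α / (α + β) by field_simp; ring, Real.rpow_sub hx, Real.rpow_one]
    rw [← Real.rpow_mul (by positivity), one_div_mul_eq_div, Real.div_rpow hy.le hx.le, hxe]
    ring
  have e2 : ((y / x) ^ (1 / (α + β))) ^ (-β) * y = x ^ (β / (α + β)) * y ^ (α / (α + β)) := by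
    have hye : y ^ (α / (α + β)) = y / y ^ (β / (α + β)) := by
      rw [show α / (α + β) = 1 - β / (α + β) by field_simp; ring, Real.rpow_sub hy, Real.rpow_one]
    rw [← Real.rpow_mul (by positivity), one_div_mul_eq_div, neg_div, Real.rpow_neg (by positivity),
      Real.div_rpow hy.le hx.le, hye, inv_div]
    ring
  rw [mul_assoc, e1, e2]
  ring

theorem ae_eq_zero_of_eLpNorm_weight_eq_zero {p γ : ℝ} (hp : 0 < p) {f : ℝ → ℂ}
    (hf : AEStronglyMeasurable f (dunklMeasure k))
    (h : eLpNorm (fun y => ((|y| ^ γ : ℝ) : ℂ) * f y) (ENNReal.ofReal p) (dunklMeasure k) = 0) :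
    f =ᵐ[dunklMeasure k] 0 := by
  have hwm : Measurable fun x : ℝ => |x| ^ γ := measurable_norm.pow_const γ
  have hm : AEStronglyMeasurable (fun y => ((|y| ^ γ : ℝ) : ℂ) * f y) (dunklMeasure k) :=
    (Complex.measurable_ofReal.comp hwm).aestronglyMeasurable.mul hf
  rw [eLpNorm_eq_zero_iff hm (by simpa using hp)] at h
  have hne : ∀ᵐ x ∂dunklMeasure k, x ≠ 0 := by
    rw [ae_iff]
    simpa using dunklMeasure_singleton k 0
  filter_upwards [h, hne] with x hx hx0
  have hpos : |x| ^ γ ≠ 0 := (Real.rpow_pos_of_pos (abs_pos.2 hx0) γ).ne'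
  rcases mul_eq_zero.1 hx with h1 | h1
  · exact absurd (Complex.ofReal_eq_zero.1 h1) hpos
  · exact h1

/-- The two-term bound from which the uncertainty inequality follows by optimizing `r`. On
`|lam| ≤ r`, the transform of `f` restricted to `|x| ≤ 1 / r` is estimated in `L^∞`, and that of
the rest of `f` by Hausdorff–Young. -/
theorem exists_eLpNorm_le_add {p q α β b : ℝ} (hk : -(1 / 2 : ℝ) ≤ k)
    (hpq : p.HolderConjugate q) (hα : 0 < α) (hα' : α < 2 * (k + 1) / q) (hβ : 0 < β)
    (hb : b ≠ 0) {C : ℝ} (hC : 0 < C)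
    (hY : ∀ M : Matrix.SpecialLinearGroup (Fin 2) ℝ, M 0 1 = b →
      ∀ f, Integrable f (dunklMeasure k) →
      eLpNorm (lcdt k M f) (ENNReal.ofReal q) (dunklMeasure k) ≤
        ENNReal.ofReal C * eLpNorm f (ENNReal.ofReal p) (dunklMeasure k)) :
    ∃ K : ℝ, 0 < K ∧ ∀ M : Matrix.SpecialLinearGroup (Fin 2) ℝ, M 0 1 = b →
      ∀ f g, IsLCDT k M p q f g → ∀ r : ℝ, 0 < r →
      eLpNorm g (ENNReal.ofReal q) (dunklMeasure k) ≤
        ENNReal.ofReal (K * r ^ α) *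
          eLpNorm (fun y => ((|y| ^ α : ℝ) : ℂ) * f y) (ENNReal.ofReal p) (dunklMeasure k) +
        ENNReal.ofReal (r ^ (-β)) *
          eLpNorm (fun lam => ((|lam| ^ β : ℝ) : ℂ) * g lam) (ENNReal.ofReal q)
            (dunklMeasure k) := by
  have hq : 0 < q := hpq.symm.pos
  have hp1 : 1 ≤ p := hpq.lt.le
  have hq1 : 1 ≤ q := hpq.symm.lt.le
  have hq1' : 1 ≤ ENNReal.ofReal q := ENNReal.one_le_ofReal.2 hq1
  have hb' : 0 < |b| := abs_pos.2 hb
  obtain ⟨D, hD, hDle⟩ := exists_setLIntegral_enorm_le (k := k) hk hpq (α := α) (by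
    rw [lt_div_iff₀ hq] at hα'
    linarith)
  obtain ⟨V, hV, hVle⟩ := exists_setLIntegral_abs_rpow_le (k := k) (a := 0) hk (by linarith)
  refine ⟨|b| ^ (-(k + 1)) * D * V ^ (1 / q) + C, by positivity, fun M hM f g h r hr => ?_⟩
  subst hM
  set X := eLpNorm (fun y => ((|y| ^ α : ℝ) : ℂ) * f y) (ENNReal.ofReal p) (dunklMeasure k)
  set Y := eLpNorm (fun y => ((|y| ^ β : ℝ) : ℂ) * g y) (ENNReal.ofReal q) (dunklMeasure k)
  set B : Set ℝ := {x : ℝ | |x| ≤ r} with hB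
  have hBm : MeasurableSet B := measurableSet_abs_le r
  have hf : MemLp f (ENNReal.ofReal p) (dunklMeasure k) := h.1
  have hg : MemLp g (ENNReal.ofReal q) (dunklMeasure k) := h.2.1
  set u := {x : ℝ | |x| ≤ r⁻¹}.indicator f with hu
  have hu1 : MemLp u 1 (dunklMeasure k) := memLp_one_indicator_of_memLp hk hp1 hf _
  have hup : MemLp u (ENNReal.ofReal p) (dunklMeasure k) := hf.indicator (measurableSet_abs_le _)
  have hTm : AEStronglyMeasurable (lcdt k M u) (dunklMeasure k) :=
    (continuous_lcdt hk hb (memLp_one_iff_integrable.1 hu1)).aestronglyMeasurable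
  have hsplit : eLpNorm g (ENNReal.ofReal q) (dunklMeasure k) ≤
      (eLpNorm (B.indicator (lcdt k M u)) (ENNReal.ofReal q) (dunklMeasure k) +
        eLpNorm (B.indicator (g - lcdt k M u)) (ENNReal.ofReal q) (dunklMeasure k)) +
        eLpNorm (g - B.indicator g) (ENNReal.ofReal q) (dunklMeasure k) := by
    have e : g = (B.indicator (lcdt k M u) + B.indicator (g - lcdt k M u)) +
        (g - B.indicator g) := by
      rw [← Set.indicator_add', add_sub_cancel, add_sub_cancel]
    have m1 := hTm.indicator hBm
    have m2 := (hg.1.sub hTm).indicator hBm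
    conv_lhs => rw [e]
    refine (eLpNorm_add_le (m1.add m2) (hg.1.sub (hg.1.indicator hBm)) hq1').trans ?_
    exact add_le_add (eLpNorm_add_le m1 m2 hq1') le_rfl
  have hnear : eLpNorm (B.indicator (lcdt k M u)) (ENNReal.ofReal q) (dunklMeasure k) ≤
      ENNReal.ofReal (|M 0 1| ^ (-(k + 1)) * D * V ^ (1 / q) * r ^ α) * X := by
    have hball : dunklMeasure k B ^ (1 / q) ≤
        ENNReal.ofReal (V ^ (1 / q) * r ^ ((2 * k + 2) / q)) := by
      have h1 := hVle r hr
      simp only [neg_zero, Real.rpow_zero, ENNReal.ofReal_one, sub_zero] at h1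
      rw [setLIntegral_one] at h1
      refine (ENNReal.rpow_le_rpow h1 (by positivity)).trans_eq ?_
      rw [ENNReal.ofReal_rpow_of_nonneg (by positivity) (by positivity),
        Real.mul_rpow hV.le (by positivity), ← Real.rpow_mul hr.le, mul_one_div]
    have hint : ∫⁻ x, ‖u x‖ₑ ∂dunklMeasure k ≤
        ENNReal.ofReal (D * r⁻¹ ^ ((2 * k + 2) / q - α)) * X := by
      refine le_trans (le_of_eq ?_) (hDle f hf.1 r⁻¹ (by positivity))
      rw [← lintegral_indicator (measurableSet_abs_le _)]
      exact lintegral_congr fun x => by rw [hu, enorm_indicator_eq_indicator_enorm]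
    refine (eLpNorm_indicator_lcdt_le hk hb hq u r).trans ?_
    refine (mul_le_mul' (mul_le_mul_right hint _) hball).trans_eq ?_
    rw [← mul_assoc, mul_right_comm, ← ENNReal.ofReal_mul (by positivity),
      ← ENNReal.ofReal_mul (by positivity)]
    congr 2
    have hrr : r⁻¹ ^ ((2 * k + 2) / q - α) * r ^ ((2 * k + 2) / q) = r ^ α := by
      rw [Real.inv_rpow hr.le, ← Real.rpow_neg hr.le, ← Real.rpow_add hr]
      congr 1
      ring
    rw [← hrr]
    ring
  have hfar : eLpNorm (B.indicator (g - lcdt k M u)) (ENNReal.ofReal q) (dunklMeasure k) ≤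
      ENNReal.ofReal (C * r ^ α) * X := by
    refine (eLpNorm_indicator_le _).trans
      ((h.eLpNorm_sub_le hk hb hp1 hq1 (hY M rfl) hu1 hup).trans ?_)
    refine (mul_le_mul_right
      (eLpNorm_sub_indicator_le hα (inv_pos.2 hr) f) _).trans_eq ?_
    rw [← mul_assoc, ← ENNReal.ofReal_mul hC.le, Real.inv_rpow hr.le, Real.rpow_neg hr.le, inv_inv]
  refine hsplit.trans (add_le_add ((add_le_add hnear hfar).trans_eq ?_)
    (eLpNorm_sub_indicator_le hβ hr g))
  rw [← add_mul, ← ENNReal.ofReal_add (by positivity) (by positivity), ← add_mul]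

end Dunkl

end

theorem theoremt (k p q α β b : ℝ) (hk : -(1 / 2 : ℝ) ≤ k) (hp1 : 1 < p) (hp2 : p ≤ 2)
    (hpq : p.HolderConjugate q) (hα : 0 < α) (hα' : α < 2 * (k + 1) / q) (hβ : 0 < β)
    (hb : b ≠ 0) :
    ∃ C : ℝ, 0 < C ∧
      ∀ M : Matrix.SpecialLinearGroup (Fin 2) ℝ, M 0 1 = b →
      ∀ f : ℝ → ℂ, MemLp f (ENNReal.ofReal p) (Dunkl.dunklMeasure k) →
      ∃ g : ℝ → ℂ, Dunkl.IsLCDT k M p q f g ∧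
        (∀ h : ℝ → ℂ, Dunkl.IsLCDT k M p q f h → h =ᵐ[Dunkl.dunklMeasure k] g) ∧
        eLpNorm g (ENNReal.ofReal q) (Dunkl.dunklMeasure k) ≤
          ENNReal.ofReal C *
            eLpNorm (fun y => ((|y| ^ α : ℝ) : ℂ) * f y) (ENNReal.ofReal p)
              (Dunkl.dunklMeasure k) ^ (β / (α + β)) *
            eLpNorm (fun lam => ((|lam| ^ β : ℝ) : ℂ) * g lam) (ENNReal.ofReal q)
              (Dunkl.dunklMeasure k) ^ (α / (α + β)) := by
  have hq1 : 1 ≤ q := hpq.symm.lt.le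
  obtain ⟨C, hC, hY⟩ := Dunkl.exists_eLpNorm_lcdt_le hk hp1 hp2 hpq hb
  obtain ⟨K, hK, hKle⟩ := Dunkl.exists_eLpNorm_le_add hk hpq hα hα' hβ hb hC hY
  refine ⟨K + 1, by positivity, fun M hM f hf => ?_⟩
  have hb' : M 0 1 ≠ 0 := hM ▸ hb
  obtain ⟨g, hg⟩ := Dunkl.exists_isLCDT hk hb' hp1.le hq1 hC (hY M hM) hf
  refine ⟨g, hg, fun h hh => hg.ae_eq hk hb' hp1.le hq1 (hY M hM) hh,
    Dunkl.le_mul_rpow_of_forall_le hα hβ hK (fun hX => ?_) (fun hY0 => ?_)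
      (hKle M hM f g hg)⟩
  · -- If `f` vanishes almost everywhere, so does its transform.
    have hf0 := Dunkl.ae_eq_zero_of_eLpNorm_weight_eq_zero (by linarith) hf.1 hX
    have hle := hg.eLpNorm_sub_le hk hb' hp1.le hq1 (hY M hM) (u := 0) MemLp.zero MemLp.zero
    have hT0 : Dunkl.lcdt k M 0 = 0 := by
      ext x
      simp [Dunkl.lcdt_eq hb', Dunkl.dunklTransform]
    rw [hT0, sub_zero, sub_zero, eLpNorm_congr_ae hf0, eLpNorm_zero, mul_zero] at hle
    exact le_antisymm hle bot_le
  · have hg0 := Dunkl.ae_eq_zero_of_eLpNorm_weight_eq_zero (by linarith) hg.2.1.1 hY0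
    rw [eLpNorm_congr_ae hg0, eLpNorm_zero]
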